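/- Let $\Phi$ be a finite reduced crystallographic root system with simple roots $\{\alpha_i\}_{i\in I}$, simple coroots $\alpha_i^\vee$, positive roots $\Phi^+$, and Weyl group $W$ generated by the simple reflections $s_i$. Let $w_0\in W$ be the longest element and $R(w_0)$ the set of its reduced words. **Definitions.** * To a reduced word $\mathbf i=(i_1,\dots,i_N)\in R(w_0)$ one attaches the sequence of positive roots $\beta_k=s_{i_1}\cdots s_{i_{k-1}}\alpha_{i_k}$, $1\le k\le N$. * For $J\subseteq I$ and $i\in J$, let $W_J=\langle s_j: j\in J\rangle$ and let $\omega_i^J$ be the fundamental weight of $i$ in the root system generated by $\{\alpha_j\}_{j\in J}$. The node $i$ is *braidless* in this root system if, for every $\tau\in W_J$ and all $j\ne k$ in $J$ with $\langle\alpha_j^\vee,\tau\omega_i^J\rangle>0$ and $\langle\alpha_k^\vee,\tau\omega_i^J\rangle>0$, one has $\langle\alpha_j^\vee,\alpha_k\rangle=0$. * An enumeration $i_1,\dots,i_n$ of $I$ is *good* if each $i_k$ is braidless in the root system generated by $\{\alpha_{i_k},\dots,\alpha_{i_n}\}$. * The *lexicographic order* $\prec$ on $\Phi^+$ attached to an enumeration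 $i_1,\dots,i_n$ of $I$: for $\beta=\sum_i p_i\alpha_i$ and $\beta'=\sum_i p'_i\alpha_i$ in $\Phi^+$, put $k=\min\{m:p_{i_m}\ne0\}$ and $k'=\min\{m:p'_{i_m}\neq 0\}$. Then $\beta\prec\beta'$ if $k<k'$, or if $k=k'$ and $\left(\frac{p_{i_{k+1}}}{p_{i_k}},\dots,\frac{p_{i_n}}{p_{i_k}}\right)$ is lexicographically smaller than $\left(\frac{p'_{i_{k+1}}}{p'_{i_k}},\dots,\frac{p'_{i_n}}{p'_{i_k}}\right)$. * A word $\mathbf i\in R(w_0)$ is *simply braided for* $i\in I$ if a sequence of braid moves takes it to a word with first letter $i$, where each move is either a $2$-term braid move, or a braid move such that $\alpha_i$ is the rightmost of the affected roots, in the order $\beta_1,\dots,\beta_N$ attached to the word before the move. It is *simply braided* if it is simply braided for every $i\in I$. **Statement.** 1. For every good enumeration of $I$ there is exactly one word in $R(w_0)$ whose sequence of roots satisfies $\beta_1\prec\beta_2\prec\dots\prec\beta_N$ for the attached lexicographic order, and this word is simply braided. 2. If $\Phi$ is of type $A_n$ ($n\ge1$), $B_n$ ($n\ge2$), $C_n$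 ($n\ge2$), $D_n$ ($n\ge4$), $E_6$, $E_7$ or $G_2$, then $I$ has a good enumeration, and $R(w_0)$ contains a simply braided word. Thus simply braided words exist in every type except possibly $E_8$ and $F_4$. -/

import Mathlib

namespace SimplyBraided

/-! Throughout, `P` is a root system with base `b`; the index set `I` of the simple roots is
`b.support`, the simple root `α_i` is `P.root i`, the simple coroot `α_i^∨` is `P.coroot i`
(as a linear form on the ambient space: `P.coroot' i`), and the simple reflection `s_i` is
`P.reflection i`. Words are lists of elements of `I`. -/

section Words

variable {ι K M N : Type*} [Field K] [AddCommGroup M] [Module K M] [AddCommGroup N] [Module K N]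
  {P : RootPairing ι K M N} (b : P.Base)

/-- The Weyl group element `s_{i_1} s_{i_2} ⋯ s_{i_N}` of the word `(i_1, …, i_N)`. -/
def wordProd (l : List b.support) : M ≃ₗ[K] M :=
  (l.map fun i => P.reflection i).prod

/-- A word is reduced if no shorter word represents the same Weyl group element. -/
def IsReducedWord (l : List b.support) : Prop :=
  ∀ l' : List b.support, wordProd b l' = wordProd b l → l.length ≤ l'.length

/-- `l ∈ R(w₀)`: a reduced word for the longest element `w₀` of the Weyl group, that is, a reduced
word of the largest possible length. -/
def IsReducedLongWord (l : List b.support) : Prop :=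
  IsReducedWord b l ∧ ∀ l' : List b.support, IsReducedWord b l' → l'.length ≤ l.length

/-- The sequence of roots `β_k = s_{i_1} ⋯ s_{i_{k-1}} α_{i_k}` attached to a word
`(i_1, …, i_N)`. -/
def rootSeq : List b.support → List M
  | [] => []
  | i :: l => P.root i :: (rootSeq l).map (P.reflection i)

/-- The alternating word `(i, j, i, …)` of length `m`. -/
def altWord {B : Type*} : ℕ → B → B → List B
  | 0, _, _ => []
  | m + 1, i, j => i :: altWord m j i

/-- The order of `s_i s_j`, i.e. the number of terms in a braid move involving `i` and `j`. -/
noncomputable def braidOrder (i j : b.support) : ℕ :=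
  orderOf (P.reflection i * P.reflection j)

/-- `l'` is obtained from `l` by a braid move
`(…, j, k, j, …) → (…, k, j, k, …)` that is either a `2`-term braid move, or such that `α_i` is the
rightmost (in the order on roots given by `l`) of the roots affected. -/
def AllowedMove (i : b.support) (l l' : List b.support) : Prop :=
  ∃ (u v : List b.support) (j k : b.support), j ≠ k ∧
    l = u ++ altWord (braidOrder b j k) j k ++ v ∧
    l' = u ++ altWord (braidOrder b j k) k j ++ v ∧
    (braidOrder b j k = 2 ∨
      (rootSeq b (u ++ altWord (braidOrder b j k) j k)).getLast? = some (P.root i))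

/-- The word `l` is simply braided for `i`. -/
def IsSimplyBraidedFor (i : b.support) (l : List b.support) : Prop :=
  ∃ l' : List b.support, Relation.ReflTransGen (AllowedMove b i) l l' ∧ l'.head? = some i

/-- The word `l` is simply braided (for all `i ∈ I`). -/
def IsSimplyBraided (l : List b.support) : Prop :=
  ∀ i : b.support, IsSimplyBraidedFor b i l

end Words

section Orders

variable {ι K M N : Type*} [Field K] [LinearOrder K] [IsStrictOrderedRing K]
  [AddCommGroup M] [Module K M] [AddCommGroup N] [Module K N]
  {P : RootPairing ι K M N} [P.IsRootSystem] (b : P.Base) {n : ℕ}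

/-- For an enumeration `i_1, …, i_n` of `I` and `x = ∑ p_i α_i`, the coefficient `p_{i_k}`. -/
noncomputable def coord (e : Fin n ≃ b.support) (x : M) (k : Fin n) : K :=
  b.toWeightBasis.repr x (e k)

/-- `k = min {k : p_{i_k} ≠ 0}` for `x = ∑ p_i α_i`. -/
def IsLeading (e : Fin n ≃ b.support) (x : M) (k : Fin n) : Prop :=
  coord b e x k ≠ 0 ∧ ∀ j < k, coord b e x j = 0

/-- The lexicographic order `x ≺ y` (on positive roots) attached to an enumeration of `I`: either
the leading index of `x` is smaller than that of `y`, or they are both equal to `k` and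
`(p_{i_{k+1}} / p_{i_k}, …, p_{i_n} / p_{i_k})` is lexicographically smaller than
`(p'_{i_{k+1}} / p'_{i_k}, …, p'_{i_n} / p'_{i_k})`. -/
def LexLT (e : Fin n ≃ b.support) (x y : M) : Prop :=
  ∃ k k' : Fin n, IsLeading b e x k ∧ IsLeading b e y k' ∧
    (k < k' ∨ (k = k' ∧ ∃ m : Fin n, k < m ∧
      (∀ j : Fin n, k < j → j < m →
        coord b e x j / coord b e x k = coord b e y j / coord b e y k) ∧
      coord b e x m / coord b e x k < coord b e y m / coord b e y k))

/-- `l` is the reduced word of `w₀` associated with the lexicographic convex order: its sequence of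
roots `β_1, …, β_N` satisfies `β_1 ≺ β_2 ≺ ⋯ ≺ β_N`. -/
def IsLexWord (e : Fin n ≃ b.support) (l : List b.support) : Prop :=
  IsReducedLongWord b l ∧ (rootSeq b l).Pairwise (LexLT b e)

/-- `ω` is the fundamental weight `ω_i` of the root system generated by `{α_j : j ∈ J}`. -/
def IsFundamentalWeight (J : Set b.support) (i : b.support) (ω : M) : Prop :=
  ω ∈ Submodule.span K ((fun j : b.support => P.root j) '' J) ∧
    P.coroot' i ω = 1 ∧ ∀ j ∈ J, j ≠ i → P.coroot' j ω = 0

/-- The Weyl group `W_J` of the root system generated by `{α_j : j ∈ J}`. -/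
def parabolic (J : Set b.support) : Subgroup (M ≃ₗ[K] M) :=
  Subgroup.closure ((fun j : b.support => P.reflection j) '' J)

/-- `i ∈ J` is braidless for the root system generated by `{α_j : j ∈ J}`: for every `τ ∈ W_J`,
distinct simple roots `α`, `γ` of this system with `⟨α^∨, τ ω_i⟩ > 0` and `⟨γ^∨, τ ω_i⟩ > 0`
satisfy `⟨α^∨, γ⟩ = 0`. -/
def IsBraidless (J : Set b.support) (i : b.support) : Prop :=
  ∀ ω : M, IsFundamentalWeight b J i ω → ∀ τ ∈ parabolic b J, ∀ j ∈ J, ∀ k ∈ J, j ≠ k →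
    0 < P.coroot' j (τ ω) → 0 < P.coroot' k (τ ω) → P.coroot' j (P.root k) = 0

/-- The enumeration `i_1, …, i_n` of `I` is good: each `i_k` is braidless for the root system
generated by `{α_{i_k}, …, α_{i_n}}`. -/
def IsGoodEnumeration (e : Fin n ≃ b.support) : Prop :=
  ∀ k : Fin n, IsBraidless b (e '' Set.Ici k) (e k)

end Orders

section Types

variable {ι K M N : Type*} [Field K] [CharZero K]
  [AddCommGroup M] [Module K M] [AddCommGroup N] [Module K N]
  {P : RootPairing ι K M N} [P.IsCrystallographic] (b : P.Base)

/-- The simple roots can be enumerated so that the Cartan matrix is `A`. -/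
def HasCartanMatrix {n : ℕ} (A : Matrix (Fin n) (Fin n) ℤ) : Prop :=
  ∃ e : Fin n ≃ b.support, ∀ i j : Fin n, b.cartanMatrix (e i) (e j) = A i j

/-- The root system has one of the Cartan–Killing types
`A_n` (`n ≥ 1`), `B_n` (`n ≥ 2`), `C_n` (`n ≥ 2`), `D_n` (`n ≥ 4`), `E₆`, `E₇`, `G₂`, i.e. any type
of a simple Lie algebra other than `E₈` and `F₄`. -/
def HasTypeOtherThanE8F4 : Prop :=
  (∃ n, 1 ≤ n ∧ HasCartanMatrix b (CartanMatrix.A n)) ∨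
  (∃ n, 2 ≤ n ∧ HasCartanMatrix b (CartanMatrix.B n)) ∨
  (∃ n, 2 ≤ n ∧ HasCartanMatrix b (CartanMatrix.C n)) ∨
  (∃ n, 4 ≤ n ∧ HasCartanMatrix b (CartanMatrix.D n)) ∨
  HasCartanMatrix b CartanMatrix.E₆ ∨
  HasCartanMatrix b CartanMatrix.E₇ ∨
  HasCartanMatrix b CartanMatrix.G₂

end Types

end SimplyBraided

set_option linter.unusedSectionVars false

namespace SimplyBraided

/-! Reduced words are handled through their root sequences: a word is reduced exactly when all its
roots are positive (`isReducedWord_iff_posWord`), and these roots are then the inversions of its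
product (`PosWord.mem_rootSeq_iff`). The lexicographic order is convex by the mediant inequality
(`lexKey_convex`), and a convex total order on the positive roots is the root order of exactly one
reduced word of `w₀`.

For a good enumeration fix `α = α_{i_k}`. The roots before `α` in the lexicographic word are those
of leading index below `k`, so they form blocks of constant leading index, and `α` is moved left
past one block at a time, the nearest block first. Let `u` be the product of the prefix before the
block of leading index `m`, and `ω` the fundamental weight of `i_m` for `J = {i_m, …, i_n}`. All
roots of the block pair positively with `ω`. If two simple reflections at `τ u`, with `τ ∈ W_J`,
both cross roots of the block, then braidlessness applied to `τ⁻¹ ω` makes them commute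
(`isBraidlessRegion_leadingRoots`). Hence reduced words inside the block are connected by 2-term
moves (`IsBraidlessRegion.reflTransGen`). If a root `β` of the block stands just before `α`, every
root `p β - q α` with `p > 0` is in the block too. So 2-term moves can gather the rank-two subsystem
of `α` and `β` directly before `α`, and one braid move with `α` rightmost carries `α` past it
(`IsBraidlessRegion.exists_move`).

Good enumerations come from small Weyl orbits: the weights `±ε_t` of the standard representation in
the classical types, and explicitly computed orbits in types `E₆`, `E₇` and `G₂`. -/

variable {ι K M N : Type*} [Field K] [LinearOrder K] [IsStrictOrderedRing K]
  [AddCommGroup M] [Module K M] [AddCommGroup N] [Module K N] [Finite ι]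
  {P : RootPairing ι K M N} [P.IsRootSystem] [P.IsCrystallographic] [P.IsReduced]
  {b : P.Base}

/-! ### Positive roots and their coordinates. -/

variable (b) in
/-- `x` is a positive root. -/
def IsPosRoot (x : M) : Prop := ∃ i, b.IsPos i ∧ P.root i = x

lemma IsPosRoot.mem_range {x : M} (h : IsPosRoot b x) : x ∈ Set.range P.root := by
  obtain ⟨i, _, rfl⟩ := h
  exact ⟨i, rfl⟩

lemma isPosRoot_root (i : b.support) : IsPosRoot b (P.root i) :=
  ⟨i, RootPairing.Base.isPos_of_mem_support i.2, rfl⟩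

lemma isPosRoot_root_iff {i : ι} : IsPosRoot b (P.root i) ↔ b.IsPos i :=
  ⟨fun ⟨_, hj, h⟩ => P.root.injective h ▸ hj, fun h => ⟨i, h, rfl⟩⟩

lemma IsPosRoot.not_neg {x : M} (h : IsPosRoot b x) : ¬ IsPosRoot b (-x) := by
  obtain ⟨i, hi, rfl⟩ := h
  have e : -P.root i = P.root (P.reflectionPerm i i) := by simp
  rw [e, isPosRoot_root_iff]
  exact fun h => (RootPairing.Base.IsPos.neg_iff_not b i).1 h hi

lemma isPosRoot_or_neg {x : M} (h : x ∈ Set.range P.root) :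
    IsPosRoot b x ∨ IsPosRoot b (-x) := by
  obtain ⟨i, rfl⟩ := h
  have e : -P.root i = P.root (P.reflectionPerm i i) := by simp
  rw [e, isPosRoot_root_iff, isPosRoot_root_iff]
  exact RootPairing.Base.IsPos.or_neg b i

lemma isPosRoot_neg_iff {x : M} (h : x ∈ Set.range P.root) :
    IsPosRoot b (-x) ↔ ¬ IsPosRoot b x :=
  ⟨fun h1 h2 => h2.not_neg h1, fun h1 => (isPosRoot_or_neg h).resolve_left h1⟩

lemma IsPosRoot.add {x y : M} (hx : IsPosRoot b x) (hy : IsPosRoot b y)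
    (h : x + y ∈ Set.range P.root) : IsPosRoot b (x + y) := by
  obtain ⟨i, hi, rfl⟩ := hx
  obtain ⟨j, hj, rfl⟩ := hy
  obtain ⟨k, hk⟩ := h
  exact ⟨k, hi.add hj hk, hk⟩

lemma IsPosRoot.reflection {x : M} (hx : IsPosRoot b x) (i : b.support) (h : x ≠ P.root i) :
    IsPosRoot b (P.reflection i x) := by
  obtain ⟨j, hj, rfl⟩ := hx
  exact ⟨P.reflectionPerm i j, hj.reflectionPerm i.2 (fun e => h (by rw [e])), by simp⟩

lemma IsPosRoot.repr_nonneg {x : M} (hx : IsPosRoot b x) (i : b.support) :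
    0 ≤ b.toWeightBasis.repr x i := by
  classical
  obtain ⟨j, hj, rfl⟩ := hx
  refine hj.induction_on_add (p := fun j => 0 ≤ b.toWeightBasis.repr (P.root j) i) ?_ ?_
  · intro j hj
    have := b.toWeightBasis_repr_root ⟨j, hj⟩
    simp only at this
    rw [this, Finsupp.single_apply]
    split_ifs <;> simp
  · intro j k l h ih hk
    have := b.toWeightBasis_repr_root ⟨k, hk⟩
    simp only at this
    rw [h, map_add, this, Finsupp.add_apply, Finsupp.single_apply]
    split_ifs <;> simp <;> linarith

lemma isPosRoot_of_repr_pos {x : M} (hx : x ∈ Set.range P.root) (i : b.support)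
    (h : 0 < b.toWeightBasis.repr x i) : IsPosRoot b x := by
  refine (isPosRoot_or_neg hx).resolve_right fun h' => ?_
  have := h'.repr_nonneg i
  simp only [map_neg, Finsupp.neg_apply] at this
  linarith

/-- A positive root is either simple or the sum of two positive roots. -/
lemma IsPosRoot.simple_or_add {x : M} (hx : IsPosRoot b x) :
    (∃ i : b.support, x = P.root i) ∨ ∃ y z, IsPosRoot b y ∧ IsPosRoot b z ∧ x = y + z := by
  obtain ⟨j, hj, rfl⟩ := hx
  refine (hj.induction_on_add (p := fun j => b.IsPos j ∧ ((∃ i : b.support, P.root j = P.root i) ∨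
      ∃ y z, IsPosRoot b y ∧ IsPosRoot b z ∧ P.root j = y + z)) ?_ ?_).2
  · exact fun i hi => ⟨RootPairing.Base.isPos_of_mem_support hi, .inl ⟨⟨i, hi⟩, rfl⟩⟩
  · intro i k l h ih hk
    have hk' := RootPairing.Base.isPos_of_mem_support hk
    exact ⟨ih.1.add hk' h, .inr ⟨_, _, ⟨i, ih.1, rfl⟩, ⟨k, hk', rfl⟩, h⟩⟩

lemma root_injective {i j : b.support} (h : P.root i = P.root j) : i = j :=
  Subtype.ext (P.root.injective h)

/-- Reducedness leaves only `x = ±y`, and positivity excludes the minus sign. -/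
lemma eq_of_eq_smul {x y : M} (hx : IsPosRoot b x) (hy : IsPosRoot b y) {c : K}
    (h : x = c • y) : x = y := by
  obtain ⟨i, _, rfl⟩ := hx.mem_range
  obtain ⟨j, _, rfl⟩ := hy.mem_range
  by_contra hne
  have hij : i ≠ j := fun e => hne (by rw [e])
  by_cases hn : P.root i = -P.root j
  · rw [hn] at hx
    exact hy.not_neg hx
  · have := RootPairing.IsReduced.linearIndependent P hij hn
    rw [LinearIndependent.pair_iff] at this
    have := this 1 (-c) (by rw [h]; module)
    simp at this

lemma range_root_neg {x : M} : -x ∈ Set.range P.root ↔ x ∈ Set.range P.root :=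
  P.neg_mem_range_root_iff

/-! ### Words, root sequences and conjugation of reflections. -/

@[simp] lemma wordProd_nil : wordProd b [] = 1 := rfl

@[simp] lemma wordProd_cons (i : b.support) (l : List b.support) :
    wordProd b (i :: l) = P.reflection i * wordProd b l := by
  simp [wordProd]

@[simp] lemma wordProd_append (l l' : List b.support) :
    wordProd b (l ++ l') = wordProd b l * wordProd b l' := by
  simp [wordProd]

lemma reflection_mul_self (i : ι) : P.reflection i * P.reflection i = 1 := by
  rw [← sq, P.reflection_sq]

lemma wordProd_reverse (l : List b.support) : wordProd b l.reverse = (wordProd b l)⁻¹ := by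
  induction l with
  | nil => simp
  | cons i l ih => simp [ih]

@[simp] lemma rootSeq_nil : rootSeq b [] = [] := rfl

@[simp] lemma rootSeq_cons (i : b.support) (l : List b.support) :
    rootSeq b (i :: l) = P.root i :: (rootSeq b l).map (P.reflection i) := rfl

@[simp] lemma length_rootSeq (l : List b.support) : (rootSeq b l).length = l.length := by
  induction l with
  | nil => rfl
  | cons i l ih => simp [ih]

lemma rootSeq_append (l l' : List b.support) :
    rootSeq b (l ++ l') = rootSeq b l ++ (rootSeq b l').map (wordProd b l) := by
  induction l with
  | nil => simp
  | cons i l ih => simp [ih]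

lemma rootSeq_concat (l : List b.support) (i : b.support) :
    rootSeq b (l ++ [i]) = rootSeq b l ++ [wordProd b l (P.root i)] := by
  simp [rootSeq_append]

lemma rootSeq_take (l : List b.support) (n : ℕ) :
    rootSeq b (l.take n) = (rootSeq b l).take n := by
  induction l generalizing n with
  | nil => simp
  | cons i l ih => cases n <;> simp [ih]

lemma rootSeq_injective : Function.Injective (rootSeq b) := by
  intro l l' h
  induction l generalizing l' with
  | nil => cases l' <;> simp_all
  | cons i l ih =>
    cases l' with
    | nil => simp at h
    | cons j l' =>
      simp only [rootSeq_cons, List.cons.injEq] at h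
      obtain rfl := root_injective h.1
      rw [ih ((List.map_injective_iff.2 (P.reflection i).injective) h.2)]

lemma wordProd_root_mem (l : List b.support) {x : M} (h : x ∈ Set.range P.root) :
    wordProd b l x ∈ Set.range P.root := by
  induction l generalizing x with
  | nil => simpa using h
  | cons i l ih =>
    obtain ⟨j, hj⟩ := ih h
    exact ⟨P.reflectionPerm i j, by simp [hj]⟩

lemma wordProd_inv_root_mem (l : List b.support) {x : M} (h : x ∈ Set.range P.root) :
    (wordProd b l)⁻¹ x ∈ Set.range P.root := by
  rw [← wordProd_reverse]
  exact wordProd_root_mem _ h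

lemma linearEquiv_inv_apply_self (w : M ≃ₗ[K] M) (x : M) : w⁻¹ (w x) = x :=
  w.symm_apply_apply x

lemma linearEquiv_apply_inv_self (w : M ≃ₗ[K] M) (x : M) : w (w⁻¹ x) = x :=
  w.apply_symm_apply x

lemma reflection_conj (l : List b.support) {i k : ι}
    (h : P.root k = wordProd b l (P.root i)) :
    P.reflection k = wordProd b l * P.reflection i * (wordProd b l)⁻¹ := by
  induction l generalizing k with
  | nil =>
    obtain rfl := P.root.injective h
    simp
  | cons j l ih =>
    have h' : P.root (P.reflectionPerm j k) = wordProd b l (P.root i) := by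
      simp [h]
    have := ih h'
    rw [RootPairing.reflection_reflectionPerm] at this
    rw [wordProd_cons, mul_inv_rev, P.reflection_inv]
    calc P.reflection k = P.reflection j * (P.reflection j * P.reflection k * P.reflection j) *
          P.reflection j := by
          simp only [← mul_assoc, reflection_mul_self, one_mul]
          rw [mul_assoc, reflection_mul_self, mul_one]
      _ = _ := by rw [this]; simp only [mul_assoc]

lemma reflection_eq_of_root_neg {i k : ι} (h : P.root k = -P.root i) :
    P.reflection k = P.reflection i := by
  rw [RootPairing.root_eq_neg_iff] at h
  rw [h, RootPairing.reflection_reflectionPerm, mul_assoc, reflection_mul_self, mul_one]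

/-- If two simple roots have, up to sign, conjugate images, then the corresponding
elements satisfy the exchange relation. -/
lemma wordProd_mul_reflection_comm (l l' : List b.support) (i j : b.support)
    (h : wordProd b l (P.root i) = wordProd b l' (P.root j) ∨
      wordProd b l (P.root i) = -wordProd b l' (P.root j)) :
    wordProd b l * P.reflection i * (wordProd b l)⁻¹ =
      wordProd b l' * P.reflection j * (wordProd b l')⁻¹ := by
  obtain ⟨k, hk⟩ := wordProd_root_mem (b := b) l ⟨i, rfl⟩
  obtain ⟨k', hk'⟩ := wordProd_root_mem (b := b) l' ⟨j, rfl⟩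
  rw [← reflection_conj l hk, ← reflection_conj l' hk']
  rw [← hk, ← hk'] at h
  rcases h with h | h
  · rw [P.root.injective h]
  · rw [reflection_eq_of_root_neg h]

lemma exists_split_of_mem_rootSeq {l : List b.support} {x : M} (h : x ∈ rootSeq b l) :
    ∃ (u : List b.support) (c : b.support) (v : List b.support), l = u ++ c :: v ∧ x = wordProd b u (P.root c) := by
  induction l generalizing x with
  | nil => simp at h
  | cons i l ih =>
    rw [rootSeq_cons, List.mem_cons, List.mem_map] at h
    rcases h with rfl | ⟨y, hy, rfl⟩
    · exact ⟨[], i, l, rfl, by simp⟩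
    · obtain ⟨u, c, v, rfl, rfl⟩ := ih hy
      exact ⟨i :: u, c, v, rfl, by simp⟩

/-- With `w = u s_c v`, the hypothesis says that `w s_i w⁻¹` and `u s_c u⁻¹` are the same
reflection, so `w s_i = u s_c u⁻¹ w = u v`. -/
lemma wordProd_delete (u v : List b.support) (c i : b.support)
    (h : wordProd b (u ++ c :: v) (P.root i) = wordProd b u (P.root c) ∨
      wordProd b (u ++ c :: v) (P.root i) = -wordProd b u (P.root c)) :
    wordProd b (u ++ v) = wordProd b (u ++ c :: v) * P.reflection i := by
  have := wordProd_mul_reflection_comm _ _ _ _ h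
  rw [mul_inv_eq_iff_eq_mul] at this
  rw [this]
  simp only [wordProd_append, wordProd_cons, mul_assoc]
  rw [inv_mul_cancel_left, ← mul_assoc (P.reflection c), reflection_mul_self, one_mul]

/-! ### Reduced words, inversions and the longest element. -/

variable (b) in
/-- All roots in the root sequence of the word are positive. -/
def PosWord (l : List b.support) : Prop := ∀ x ∈ rootSeq b l, IsPosRoot b x

lemma posWord_concat {l : List b.support} {i : b.support} :
    PosWord b (l ++ [i]) ↔ PosWord b l ∧ IsPosRoot b (wordProd b l (P.root i)) := by
  simp only [PosWord, rootSeq_concat, List.mem_append, List.mem_singleton]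
  constructor
  · exact fun h => ⟨fun x hx => h x (.inl hx), h _ (.inr rfl)⟩
  · rintro ⟨h, h'⟩ x (hx | rfl)
    exacts [h x hx, h']

lemma PosWord.of_append {l l' : List b.support} (h : PosWord b (l ++ l')) : PosWord b l :=
  fun x hx => h x (by rw [rootSeq_append]; exact List.mem_append_left _ hx)

/-- The root sequence of a reduced word enumerates the inversions. -/
lemma PosWord.mem_rootSeq_iff {l : List b.support} (h : PosWord b l) {x : M} :
    x ∈ rootSeq b l ↔ IsPosRoot b x ∧ IsPosRoot b (-(wordProd b l)⁻¹ x) := by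
  induction l using List.reverseRecOn generalizing x with
  | nil => simpa using fun h => h.not_neg
  | append_singleton l i ih =>
    obtain ⟨h1, h2⟩ := posWord_concat.1 h
    have key : -(wordProd b (l ++ [i]))⁻¹ x = P.reflection i (-(wordProd b l)⁻¹ x) := by
      simp
    rw [rootSeq_concat, List.mem_append, List.mem_singleton, ih h1, key]
    have ne_of_pos (hx : IsPosRoot b x) : -(wordProd b l)⁻¹ x ≠ P.root i := by
      intro e
      rw [← e, map_neg, linearEquiv_apply_inv_self] at h2
      exact hx.not_neg h2
    constructor
    · rintro (⟨hx, hx'⟩ | rfl)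
      · exact ⟨hx, hx'.reflection i (ne_of_pos hx)⟩
      · rw [linearEquiv_inv_apply_self, map_neg, P.reflection_apply_self, neg_neg]
        exact ⟨h2, isPosRoot_root i⟩
    · rintro ⟨hx, hx'⟩
      by_cases e : P.reflection i (-(wordProd b l)⁻¹ x) = P.root i
      · right
        have := congrArg (P.reflection i) e
        rw [P.reflection_same, P.reflection_apply_self, neg_inj] at this
        rw [← this, linearEquiv_apply_inv_self]
      · left
        refine ⟨hx, ?_⟩
        simpa only [P.reflection_same] using hx'.reflection i e

lemma PosWord.nodup {l : List b.support} (h : PosWord b l) : (rootSeq b l).Nodup := by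
  induction l using List.reverseRecOn with
  | nil => simp
  | append_singleton l i ih =>
    obtain ⟨h1, h2⟩ := posWord_concat.1 h
    rw [rootSeq_concat, List.nodup_append]
    refine ⟨ih h1, by simp, ?_⟩
    intro x hx y hy e
    rw [List.mem_singleton] at hy
    rw [e, hy, h1.mem_rootSeq_iff, linearEquiv_inv_apply_self] at hx
    exact (isPosRoot_root i).not_neg hx.2

lemma PosWord.perm {l l' : List b.support} (h : PosWord b l) (h' : PosWord b l')
    (e : wordProd b l = wordProd b l') : (rootSeq b l).Perm (rootSeq b l') := by
  rw [List.perm_ext_iff_of_nodup h.nodup h'.nodup]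
  intro x
  rw [h.mem_rootSeq_iff, h'.mem_rootSeq_iff, e]

lemma PosWord.length_eq {l l' : List b.support} (h : PosWord b l) (h' : PosWord b l')
    (e : wordProd b l = wordProd b l') : l.length = l'.length := by
  simpa using (h.perm h' e).length_eq

lemma PosWord.neg_mem_rootSeq {l : List b.support} (h : PosWord b l) {i : b.support}
    (hi : IsPosRoot b (-wordProd b l (P.root i))) : -wordProd b l (P.root i) ∈ rootSeq b l := by
  rw [h.mem_rootSeq_iff]
  refine ⟨hi, ?_⟩
  rw [map_neg, linearEquiv_inv_apply_self, neg_neg]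
  exact isPosRoot_root i

/-- The exchange property on the right. -/
lemma PosWord.exists_delete {l : List b.support} (h : PosWord b l) {i : b.support}
    (hi : IsPosRoot b (-wordProd b l (P.root i))) :
    ∃ (u : List b.support) (c : b.support) (v : List b.support), l = u ++ c :: v ∧
      wordProd b (u ++ v) = wordProd b l * P.reflection i := by
  obtain ⟨u, c, v, rfl, e⟩ := exists_split_of_mem_rootSeq (h.neg_mem_rootSeq hi)
  exact ⟨u, c, v, rfl, wordProd_delete u v c i (.inr (by rw [← e, neg_neg]))⟩

lemma IsReducedWord.posWord {l : List b.support} (h : IsReducedWord b l) : PosWord b l := by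
  by_contra hneg
  have aux : ∀ l : List b.support, ¬ PosWord b l → ∃ (u : List b.support) (i : b.support) (v : List b.support),
      l = u ++ i :: v ∧ PosWord b u ∧
      ¬ IsPosRoot b (wordProd b u (P.root i)) := by
    intro l hl
    induction l using List.reverseRecOn with
    | nil => simp [PosWord] at hl
    | append_singleton l i ih =>
      by_cases h : PosWord b l
      · exact ⟨l, i, [], rfl, h, fun h' => hl (posWord_concat.2 ⟨h, h'⟩)⟩
      · obtain ⟨u, j, v, rfl, hu⟩ := ih h
        exact ⟨u, j, v ++ [i], by simp, hu⟩
  -- At the first non-positive root the exchange property removes a letter of `u` together with `i`,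
  -- which makes the word two letters shorter.
  obtain ⟨u, i, v, rfl, hu, hi⟩ := aux l hneg
  have hneg' := (isPosRoot_neg_iff (wordProd_root_mem u ⟨i, rfl⟩)).2 hi
  obtain ⟨u₁, c, u₂, rfl, this⟩ := hu.exists_delete hneg'
  have := h (u₁ ++ u₂ ++ v) (by
    rw [wordProd_append _ v, this, wordProd_append (u₁ ++ c :: u₂), wordProd_cons, mul_assoc])
  simp at this

lemma exists_isReducedWord (l : List b.support) :
    ∃ l', IsReducedWord b l' ∧ wordProd b l' = wordProd b l := by
  obtain ⟨l', h, h'⟩ := exists_minimalFor_of_wellFoundedLT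
    (fun l' => wordProd b l' = wordProd b l) List.length ⟨l, rfl⟩
  refine ⟨l', fun l'' e => ?_, h⟩
  by_contra hlt
  exact hlt (h' (e.trans h) (by omega))

lemma isReducedWord_iff_posWord {l : List b.support} : IsReducedWord b l ↔ PosWord b l := by
  refine ⟨IsReducedWord.posWord, fun h l' e => ?_⟩
  obtain ⟨l'', h1, h2⟩ := exists_isReducedWord l'
  rw [h.length_eq h1.posWord (e.symm.trans h2.symm)]
  exact h1 l' h2.symm

lemma PosWord.of_length_le {l l' : List b.support} (h : PosWord b l)
    (e : wordProd b l' = wordProd b l) (hl : l'.length ≤ l.length) : PosWord b l' :=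
  isReducedWord_iff_posWord.1 fun l'' e' =>
    hl.trans (isReducedWord_iff_posWord.2 h l'' (e'.trans e))

/-- A nonempty reduced word sends the simple root of its last letter to a negative root. -/
lemma eq_one_of_forall_isPosRoot (l : List b.support)
    (h : ∀ i : b.support, IsPosRoot b (wordProd b l (P.root i))) : wordProd b l = 1 := by
  obtain ⟨l', h1, h2⟩ := exists_isReducedWord l
  rw [← h2] at h ⊢
  induction l' using List.reverseRecOn with
  | nil => rfl
  | append_singleton l' i _ =>
    have h3 := (posWord_concat.1 h1.posWord).2
    have := h i
    rw [wordProd_append, wordProd_cons, wordProd_nil, mul_one, LinearEquiv.mul_apply,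
      P.reflection_apply_self, map_neg] at this
    exact absurd this h3.not_neg

/-- Here `w` need not be a Weyl group element: the lemma is applied to the negative of one. -/
lemma wordProd_pos_of_simple_pos (w : M ≃ₗ[K] M) (hw : ∀ x ∈ Set.range P.root, w x ∈ Set.range P.root)
    (h : ∀ i : b.support, IsPosRoot b (w (P.root i))) {x : M} (hx : IsPosRoot b x) :
    IsPosRoot b (w x) := by
  obtain ⟨j, hj, rfl⟩ := hx
  refine hj.induction_on_add (p := fun j => IsPosRoot b (w (P.root j))) ?_ ?_
  · exact fun i hi => h ⟨i, hi⟩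
  · intro i j k e hi hj
    have hk : w (P.root k) ∈ Set.range P.root := hw _ ⟨k, rfl⟩
    rw [e, map_add] at hk ⊢
    exact hi.add (h ⟨j, hj⟩) hk

/-- Reduced words of the longest element are those whose root sequences enumerate the positive
roots. -/
lemma isReducedLongWord_iff {l : List b.support} :
    IsReducedLongWord b l ↔ PosWord b l ∧ ∀ x, IsPosRoot b x → x ∈ rootSeq b l := by
  simp only [IsReducedLongWord, isReducedWord_iff_posWord]
  refine and_congr_right fun h => ⟨fun hmax x hx => ?_, fun hall l' h' => ?_⟩
  · by_contra hmem
    rw [h.mem_rootSeq_iff, isPosRoot_neg_iff (wordProd_inv_root_mem l hx.mem_range)] at hmem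
    have hpos : IsPosRoot b ((wordProd b l)⁻¹ x) := by
      by_contra hn
      exact hmem ⟨hx, hn⟩
    obtain ⟨i, hi⟩ : ∃ i : b.support, IsPosRoot b (wordProd b l (P.root i)) := by
      by_contra! hneg
      -- If `w` made every simple root negative, `-w` would preserve positivity; but it maps the
      -- positive root `w⁻¹ x` to `-x`.
      have := wordProd_pos_of_simple_pos (b := b) (LinearEquiv.neg K * wordProd b l)
        (fun y hy => range_root_neg.2 (wordProd_root_mem l hy))
        (fun i => (isPosRoot_neg_iff (wordProd_root_mem l ⟨i, rfl⟩)).2 (hneg i)) hpos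
      rw [LinearEquiv.mul_apply, linearEquiv_apply_inv_self] at this
      exact hx.not_neg this
    have := hmax (l ++ [i]) (posWord_concat.2 ⟨h, hi⟩)
    simp at this
  · have : (rootSeq b l').Subperm (rootSeq b l) :=
      h'.nodup.subperm fun x hx => hall x (h' x hx)
    simpa using this.length_le

/-! ### Alternating words. -/

section AltWord

variable {B : Type*}

@[simp] lemma altWord_zero (i j : B) : altWord 0 i j = [] := rfl

lemma altWord_succ (m : ℕ) (i j : B) : altWord (m + 1) i j = i :: altWord m j i := rfl

@[simp] lemma length_altWord (m : ℕ) (i j : B) : (altWord m i j).length = m := by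
  induction m generalizing i j with
  | zero => rfl
  | succ m ih => simp [altWord_succ, ih]

/-- The letter in position `m` (counting from `0`) of the alternating word `(i, j, i, …)`. -/
def altLetter (m : ℕ) (i j : B) : B := if Even m then i else j

@[simp] lemma altLetter_zero (i j : B) : altLetter 0 i j = i := rfl

lemma altLetter_succ (m : ℕ) (i j : B) : altLetter (m + 1) i j = altLetter m j i := by
  by_cases h : Even m <;> simp [altLetter, Nat.even_add_one, h]

lemma altLetter_cases (m : ℕ) (i j : B) :
    (altLetter m i j = i ∧ altLetter m j i = j) ∨ (altLetter m i j = j ∧ altLetter m j i = i) := by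
  by_cases h : Even m <;> simp [altLetter, h]

lemma altWord_concat (m : ℕ) (i j : B) :
    altWord (m + 1) i j = altWord m i j ++ [altLetter m i j] := by
  induction m generalizing i j with
  | zero => rfl
  | succ m ih => rw [altWord_succ, ih, altWord_succ, altLetter_succ, List.cons_append]

lemma altWord_add (m k : ℕ) (i j : B) :
    ∃ v, altWord (m + k) i j = altWord m i j ++ v := by
  induction k with
  | zero => exact ⟨[], by simp⟩
  | succ k ih =>
    obtain ⟨v, hv⟩ := ih
    exact ⟨v ++ [altLetter (m + k) i j], by rw [← add_assoc, altWord_concat, hv, List.append_assoc]⟩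

lemma mem_altWord {m : ℕ} {i j x : B} (h : x ∈ altWord m i j) : x = i ∨ x = j := by
  induction m generalizing i j with
  | zero => simp at h
  | succ m ih =>
    rw [altWord_succ, List.mem_cons] at h
    exact h.elim .inl fun h => (ih h).symm

lemma reverse_altWord (m : ℕ) (i j : B) :
    (altWord (m + 1) i j).reverse = altWord (m + 1) (altLetter m i j) (altLetter m j i) := by
  induction m generalizing i j with
  | zero => rfl
  | succ m ih =>
    rw [altWord_concat, List.reverse_append, ih, altWord_succ, altLetter_succ, altLetter_succ]
    rfl

end AltWord

/-! ### Rank two: braid relations and the last root of a braid block. -/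

lemma wordProd_altWord_mul_inv (m : ℕ) (i j : b.support) :
    wordProd b (altWord m i j) * (wordProd b (altWord m j i))⁻¹ =
      (P.reflection i * P.reflection j) ^ m := by
  induction m generalizing i j with
  | zero => simp
  | succ m ih =>
    rw [altWord_succ, altWord_succ, wordProd_cons, wordProd_cons, mul_inv_rev, P.reflection_inv,
      mul_assoc, ← mul_assoc (wordProd b _), ih, ← mul_assoc, ← mul_pow_mul, pow_succ, mul_assoc]

lemma repr_wordProd_of_notMem (l : List b.support) (k : b.support) (hk : k ∉ l) (x : M) :
    b.toWeightBasis.repr (wordProd b l x) k = b.toWeightBasis.repr x k := by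
  induction l with
  | nil => simp
  | cons i l ih =>
    simp only [List.mem_cons, not_or] at hk
    rw [wordProd_cons, LinearEquiv.mul_apply, P.reflection_apply, map_sub, map_smul,
      b.toWeightBasis_repr_root, Finsupp.sub_apply, ih hk.2, Finsupp.smul_apply,
      Finsupp.single_eq_of_ne hk.1]
    simp

lemma eq_smul_add_smul {x : M} {c d : b.support} (hcd : c ≠ d)
    (h : ∀ k, k ≠ c → k ≠ d → b.toWeightBasis.repr x k = 0) :
    x = b.toWeightBasis.repr x c • P.root c + b.toWeightBasis.repr x d • P.root d := by
  classical
  apply b.toWeightBasis.repr.injective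
  ext k
  simp only [map_add, map_smul, b.toWeightBasis_repr_root, Finsupp.add_apply, Finsupp.smul_apply,
    Finsupp.single_apply, smul_eq_mul]
  by_cases hc : c = k
  · subst hc
    simp [hcd.symm]
  · by_cases hd : d = k
    · subst hd
      simp [hcd]
    · simp [hc, hd, h k (Ne.symm hc) (Ne.symm hd)]

lemma PosWord.length_le [Fintype ι] {l : List b.support} (h : PosWord b l) :
    l.length ≤ Fintype.card ι := by
  classical
  have h1 := List.toFinset_card_of_nodup h.nodup
  rw [length_rootSeq] at h1
  rw [← h1]
  calc _ ≤ (Finset.univ.image P.root).card := Finset.card_le_card fun x hx => by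
        obtain ⟨i, hi⟩ := (h x (List.mem_toFinset.1 hx)).mem_range
        exact Finset.mem_image.2 ⟨i, Finset.mem_univ _, hi⟩
    _ ≤ _ := Finset.card_image_le

/-- Take the longest reduced alternating word starting with `c`; it exists because there are
finitely many roots. One simple root becomes negative because its reflection is the last letter, the
other because the word cannot be prolonged. -/
lemma exists_max_posWord_altWord (c d : b.support) :
    ∃ T, PosWord b (altWord (T + 1) c d) ∧
      IsPosRoot b (-wordProd b (altWord (T + 1) c d) (P.root c)) ∧
      IsPosRoot b (-wordProd b (altWord (T + 1) c d) (P.root d)) := by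
  classical
  have := Fintype.ofFinite ι
  have hex : ∃ t, ¬ PosWord b (altWord t c d) := ⟨Fintype.card ι + 1, fun h => by
    have := h.length_le
    simp at this⟩
  -- Lengths `0` and `1` are reduced, so the first failing length is at least `2`.
  obtain ⟨t, ht⟩ : ∃ t, Nat.find hex = t + 1 + 1 := by
    have h0 : Nat.find hex ≠ 0 := fun h => by
      have := Nat.find_spec hex
      rw [h] at this
      simp [PosWord] at this
    have h1 : Nat.find hex ≠ 1 := fun h => by
      have := Nat.find_spec hex
      rw [h] at this
      simp [PosWord, altWord_succ, isPosRoot_root] at this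
    exact ⟨Nat.find hex - 2, by omega⟩
  have hspec := Nat.find_spec hex
  have hmin : PosWord b (altWord (t + 1) c d) := by
    by_contra h
    have := Nat.find_min' hex h
    omega
  rw [ht, altWord_concat, posWord_concat, not_and] at hspec
  have h1 := (isPosRoot_neg_iff (wordProd_root_mem _ ⟨_, rfl⟩)).2 (hspec hmin)
  have hmin' := hmin
  rw [altWord_concat, posWord_concat] at hmin'
  have h2 : IsPosRoot b (-wordProd b (altWord (t + 1) c d) (P.root (altLetter (B := b.support) t c d))) := by
    rw [altWord_concat, wordProd_append, wordProd_cons, wordProd_nil, mul_one,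
      LinearEquiv.mul_apply, P.reflection_apply_self, map_neg, neg_neg]
    exact hmin'.2
  refine ⟨t, hmin, ?_⟩
  rw [altLetter_succ] at h1
  rcases altLetter_cases t c d with ⟨e, e'⟩ | ⟨e, e'⟩ <;> rw [e] at h2 <;> rw [e'] at h1
  exacts [⟨h2, h1⟩, ⟨h1, h2⟩]

/-- In a rank-two parabolic subgroup only one element makes both simple roots negative: the quotient
of two such elements keeps every simple root positive, hence is trivial. -/
lemma wordProd_eq_of_neg (l l' : List b.support) {c d : b.support} (hcd : c ≠ d)
    (hl : ∀ x ∈ l, x = c ∨ x = d) (hl' : ∀ x ∈ l', x = c ∨ x = d)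
    (hc : IsPosRoot b (-wordProd b l (P.root c))) (hd : IsPosRoot b (-wordProd b l (P.root d)))
    (hc' : IsPosRoot b (-wordProd b l' (P.root c)))
    (hd' : IsPosRoot b (-wordProd b l' (P.root d))) :
    wordProd b l' = wordProd b l := by
  classical
  have key : ∀ i : b.support, IsPosRoot b (wordProd b (l.reverse ++ l') (P.root i)) := by
    intro i
    have hoff : ∀ k, k ≠ c → k ≠ d → ∀ x, b.toWeightBasis.repr
        (wordProd b (l.reverse ++ l') x) k = b.toWeightBasis.repr x k := by
      intro k hkc hkd x
      apply repr_wordProd_of_notMem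
      simp only [List.mem_append, List.mem_reverse, not_or]
      exact ⟨fun h => (hl k h).elim hkc hkd, fun h => (hl' k h).elim hkc hkd⟩
    have hmem := wordProd_root_mem (b := b) (l.reverse ++ l') ⟨(i : ι), rfl⟩
    by_cases hi : i = c ∨ i = d
    · have hi' : IsPosRoot b (-wordProd b l' (P.root i)) := by
        rcases hi with rfl | rfl
        exacts [hc', hd']
      by_contra hneg
      rw [← isPosRoot_neg_iff hmem] at hneg
      have hz : ∀ k, k ≠ c → k ≠ d →
          b.toWeightBasis.repr (-wordProd b (l.reverse ++ l') (P.root i)) k = 0 := by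
        intro k hkc hkd
        rw [map_neg, Finsupp.neg_apply, hoff k hkc hkd, b.toWeightBasis_repr_root,
          Finsupp.single_eq_of_ne, neg_zero]
        rcases hi with rfl | rfl <;> assumption
      have hsum := eq_smul_add_smul hcd hz
      have e := congrArg (wordProd b l) hsum
      rw [map_neg, wordProd_append, LinearEquiv.mul_apply, wordProd_reverse,
        linearEquiv_apply_inv_self, map_add, map_smul, map_smul] at e
      -- In `e` the left side has nonnegative coordinates, while the right side combines two
      -- negative roots with nonnegative coefficients; so both vanish.
      have hzero : -wordProd b l' (P.root i) = 0 := by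
        apply b.toWeightBasis.repr.injective
        ext k
        have h1 := hi'.repr_nonneg k
        rw [e] at h1 ⊢
        have hc1 := hc.repr_nonneg k
        have hd1 := hd.repr_nonneg k
        simp only [map_add, map_smul, map_neg, Finsupp.add_apply, Finsupp.smul_apply,
          Finsupp.neg_apply, smul_eq_mul, map_zero, Finsupp.zero_apply] at h1 hc1 hd1 ⊢
        have hp := hneg.repr_nonneg c
        have hq := hneg.repr_nonneg d
        rw [wordProd_append, wordProd_reverse] at hp hq
        simp only [map_neg, Finsupp.neg_apply, LinearEquiv.mul_apply] at hp hq
        nlinarith [mul_nonneg hp hc1, mul_nonneg hq hd1]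
      obtain ⟨j, hj⟩ := hi'.mem_range
      exact P.ne_zero j (hj.trans hzero)
    · rw [not_or] at hi
      refine isPosRoot_of_repr_pos hmem i ?_
      rw [hoff i hi.1 hi.2, b.toWeightBasis_repr_root]
      simp
  have := eq_one_of_forall_isPosRoot _ key
  rwa [wordProd_append, wordProd_reverse, inv_mul_eq_one, eq_comm] at this

/-- The maximal alternating words from `c` and from `d` have the same product, so they have equal
length `T + 1` and `(s_c s_d)^(T+1) = 1`. The order of `s_c s_d` is therefore at most `T + 1`, and
the alternating word of that length is a prefix of a reduced word. -/
lemma posWord_altWord_and_wordProd_eq {c d : b.support} (hcd : c ≠ d) :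
    0 < braidOrder b c d ∧ PosWord b (altWord (braidOrder b c d) c d) ∧
      wordProd b (altWord (braidOrder b c d) c d) =
        wordProd b (altWord (braidOrder b c d) d c) := by
  obtain ⟨T, h1, h2, h3⟩ := exists_max_posWord_altWord c d
  obtain ⟨T', h1', h2', h3'⟩ := exists_max_posWord_altWord d c
  have e := wordProd_eq_of_neg _ _ hcd (fun x hx => mem_altWord hx)
    (fun x hx => (mem_altWord hx).symm) h2 h3 h3' h2'
  obtain rfl : T' = T := by simpa using h1'.length_eq h1 e
  have hpow : (P.reflection c * P.reflection d) ^ (T' + 1) = 1 := by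
    rw [← wordProd_altWord_mul_inv, e, mul_inv_cancel]
  have hdvd := orderOf_dvd_of_pow_eq_one hpow
  have hpos : 0 < braidOrder b c d := Nat.pos_of_dvd_of_pos hdvd (Nat.succ_pos _)
  have hle : braidOrder b c d ≤ T' + 1 := Nat.le_of_dvd (Nat.succ_pos _) hdvd
  have hprod : wordProd b (altWord (braidOrder b c d) c d) =
      wordProd b (altWord (braidOrder b c d) d c) := by
    rw [← mul_inv_eq_one, wordProd_altWord_mul_inv]
    exact pow_orderOf_eq_one _
  obtain ⟨k, hk⟩ := Nat.exists_eq_add_of_le hle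
  obtain ⟨v, hv⟩ := altWord_add (braidOrder b c d) k c d
  rw [← hk] at hv
  exact ⟨hpos, (hv ▸ h1).of_append, hprod⟩

lemma braidOrder_comm (c d : b.support) : braidOrder b c d = braidOrder b d c := by
  unfold braidOrder
  rw [← orderOf_inv, mul_inv_rev, P.reflection_inv, P.reflection_inv]

/-- With `w` the product of the first `k` letters and `z` the last letter, the braid relation reads
`w s_z = s_d w`. Applied to `α_z` it shows that `s_d` negates `w α_z`, which is thus a multiple of
`α_d`. -/
lemma altWord_last_root {c d : b.support} (hcd : c ≠ d) {k : ℕ}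
    (hk : braidOrder b c d = k + 1) :
    wordProd b (altWord k c d) (P.root (altLetter (B := b.support) k c d)) = P.root d := by
  obtain ⟨-, h1, h2⟩ := posWord_altWord_and_wordProd_eq hcd
  rw [hk] at h1 h2
  rw [altWord_concat, posWord_concat] at h1
  rw [altWord_concat, altWord_succ, wordProd_append, wordProd_cons, wordProd_cons, wordProd_nil,
    mul_one] at h2
  have h3 := congrArg (fun f => f (P.root (altLetter (B := b.support) k c d))) h2
  simp only [LinearEquiv.mul_apply, P.reflection_apply_self, map_neg] at h3
  rw [P.reflection_apply] at h3
  refine eq_of_eq_smul h1.2 (isPosRoot_root d)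
    (c := P.coroot' d (wordProd b (altWord k c d) (P.root (altLetter (B := b.support) k c d))) / 2) ?_
  set y := wordProd b (altWord k c d) (P.root (altLetter (B := b.support) k c d))
  have h4 : (2 : K) • y = P.coroot' d y • P.root d := by
    rw [two_smul]
    nth_rw 1 [← neg_neg y]
    rw [h3]
    abel
  rw [div_eq_inv_mul, mul_smul, ← h4, smul_smul, inv_mul_cancel₀ two_ne_zero, one_smul]

/-! ### Braidless regions: connecting words and moving a simple root to the left. -/

/-- If a factor of a reduced word is replaced by a word for the same element that is not longer,
the result is reduced and the roots attached to the factor are permuted. -/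
lemma PosWord.block_perm {U A A' : List b.support} (h : PosWord b (U ++ A))
    (e : wordProd b A' = wordProd b A) (hl : A'.length ≤ A.length) :
    PosWord b (U ++ A') ∧
      ((rootSeq b A').map (wordProd b U)).Perm ((rootSeq b A).map (wordProd b U)) := by
  have e' : wordProd b (U ++ A') = wordProd b (U ++ A) := by
    rw [wordProd_append, wordProd_append, e]
  have h' : PosWord b (U ++ A') := h.of_length_le e' (by simpa using hl)
  refine ⟨h', ?_⟩
  have := h'.perm h e'
  rwa [rootSeq_append, rootSeq_append, List.perm_append_left_iff] at this

/-- `Y` is a set of Weyl group elements and `S` a set of roots such that, starting in `Y` and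
crossing only roots of `S`, one never meets two non-commuting simple reflections at once. -/
structure IsBraidlessRegion (Y : Set (M ≃ₗ[K] M)) (S : Set M) : Prop where
  mul_mem : ∀ y ∈ Y, ∀ d : b.support, y (P.root d) ∈ S → y * P.reflection d ∈ Y
  braidOrder_eq : ∀ y ∈ Y, ∀ d e : b.support, d ≠ e → y (P.root d) ∈ S → y (P.root e) ∈ S →
    braidOrder b d e = 2

lemma reflection_root_of_braidOrder_eq_two {d e : b.support} (hde : d ≠ e)
    (h : braidOrder b d e = 2) : P.reflection d (P.root e) = P.root e := by
  simpa [altWord_succ, altLetter_succ] using altWord_last_root hde h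

lemma IsBraidlessRegion.reflTransGen {Y : Set (M ≃ₗ[K] M)} {S : Set M}
    (hYS : IsBraidlessRegion (b := b) Y S) (i : b.support) (V : List b.support) :
    ∀ U A A' : List b.support, wordProd b U ∈ Y → PosWord b (U ++ A) →
      (∀ x ∈ (rootSeq b A).map (wordProd b U), x ∈ S) →
      wordProd b A' = wordProd b A → A'.length = A.length →
      Relation.ReflTransGen (AllowedMove b i) (U ++ A ++ V) (U ++ A' ++ V) := by
  intro U A
  induction hn : A.length generalizing U A with
  | zero =>
    intro A' _ _ _ _ hl
    rw [List.length_eq_zero_iff] at hn hl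
    subst hn hl
    exact .refl
  | succ n ih =>
    intro A' hU hpos hS he hl
    obtain ⟨d, Q, rfl⟩ := List.exists_cons_of_length_eq_add_one hn
    obtain ⟨e, Q', rfl⟩ := List.exists_cons_of_length_eq_add_one hl
    simp only [List.length_cons, Nat.add_right_cancel_iff] at hn hl
    have hlen : ∀ {l l' : List b.support}, l.length = n → l'.length = n → l.length = l'.length :=
      fun h h' => h.trans h'.symm
    have step : ∀ (c : b.support) (B B' : List b.support), B.length = n → B'.length = n →
        wordProd b B' = wordProd b B → wordProd b (c :: B) = wordProd b (d :: Q) →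
        Relation.ReflTransGen (AllowedMove b i) (U ++ (c :: B) ++ V) (U ++ (c :: B') ++ V) := by
      intro c B B' hB hB' hBB hBQ
      obtain ⟨hp, hperm⟩ := hpos.block_perm hBQ (by simp [hB, hn])
      have hS' : ∀ x ∈ (rootSeq b (c :: B)).map (wordProd b U), x ∈ S := fun x hx =>
        hS x (hperm.subset hx)
      have hcS : wordProd b U (P.root c) ∈ S := hS' _ (by simp)
      have := ih (U ++ [c]) B hB B' (by
          rw [wordProd_append, wordProd_cons, wordProd_nil, mul_one]
          exact hYS.mul_mem _ hU c hcS)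
        (by simpa using hp)
        (fun x hx => hS' x (by
          rw [rootSeq_cons, List.map_cons, List.map_map]
          exact List.mem_cons_of_mem _ (by simpa using hx)))
        hBB hB'
      simpa using this
    by_cases hde : d = e
    · subst hde
      refine step d Q Q' hn hl ?_ rfl
      simpa using he
    obtain ⟨hp', hperm'⟩ := hpos.block_perm he (by simp [hn, hl])
    have hdS : wordProd b U (P.root d) ∈ S := hS _ (by simp)
    have hemem : wordProd b U (P.root e) ∈ (rootSeq b (d :: Q)).map (wordProd b U) :=
      hperm'.subset (by simp)
    have h2 := hYS.braidOrder_eq _ hU d e hde hdS (hS _ hemem)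
    -- The root `α_e` is an inversion of `d :: Q` other than `α_d`, and `s_d` fixes it, so it
    -- already is an inversion of `Q`. Hence `Q` can be rewritten to start with `e`.
    have hmem : P.root e ∈ rootSeq b Q := by
      rw [List.mem_map_of_injective (wordProd b U).injective, rootSeq_cons, List.mem_cons,
        List.mem_map] at hemem
      rcases hemem with h | ⟨y, hy, h⟩
      · exact absurd (root_injective h).symm hde
      · rw [← reflection_root_of_braidOrder_eq_two hde h2] at h
        rwa [← (P.reflection (d : ι)).injective h]
    obtain ⟨A₁, c, A₂, rfl, hc⟩ := exists_split_of_mem_rootSeq hmem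
    have hZ : wordProd b (e :: (A₁ ++ A₂)) = wordProd b (A₁ ++ c :: A₂) := by
      have := wordProd_mul_reflection_comm (b := b) [] A₁ e c (.inl (by simpa using hc))
      rw [wordProd_nil, one_mul, inv_one, mul_one] at this
      rw [wordProd_cons, this]
      simp [mul_assoc]
    have hcomm : P.reflection d * P.reflection e = P.reflection e * P.reflection d := by
      have := (posWord_altWord_and_wordProd_eq hde).2.2
      simpa [h2, altWord_succ] using this
    have hlZ : (A₁ ++ A₂).length + 1 = n := by
      rw [← hn]
      simp
      omega
    have hZ' : wordProd b (e :: d :: (A₁ ++ A₂)) = wordProd b (d :: (A₁ ++ c :: A₂)) := by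
      rw [wordProd_cons d (A₁ ++ c :: A₂), ← hZ, wordProd_cons, wordProd_cons, wordProd_cons,
        ← mul_assoc, ← mul_assoc, hcomm]
    have hQ' : wordProd b Q' = wordProd b (d :: (A₁ ++ A₂)) := by
      rw [← hZ', wordProd_cons, wordProd_cons] at he
      exact mul_left_cancel he
    -- With `Z = A₁ ++ A₂` the route is `d Q → d e Z → e d Z → e Q'`; the middle arrow is the 2-term
    -- move and the outer ones come from the induction hypothesis.
    refine (step d _ (e :: (A₁ ++ A₂)) hn (by simpa using hlZ) hZ rfl).trans
      (.head ?_ (step e (d :: (A₁ ++ A₂)) Q' (by simpa using hlZ) hl hQ' hZ'))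
    refine ⟨U, A₁ ++ A₂ ++ V, d, e, hde, ?_, ?_, .inl h2⟩ <;> simp [h2, altWord_succ]

/-- Let `w` be the product of `U ++ A`. A root `ρ = p α_x + q α_c` of the rank-two system with `p >
0` satisfies `-w ρ = p (-w α_x) - q α_j`, which lies in `S` and so is an inversion of `w`. Each
successive letter of the alternating word is thus a right descent, and the exchange property splits
it off. -/
lemma exists_strip_altWord {S : Set M} {U A : List b.support} {j c x : b.support} {k : ℕ}
    (hpos : PosWord b (U ++ A)) (hcx : x ≠ c) (hk : braidOrder b x c = k + 1)
    (hSpos : ∀ β ∈ S, IsPosRoot b β) (hUS : ∀ β ∈ rootSeq b U, β ∉ S)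
    (hS : ∀ β ∈ S, ∀ p q : K, 0 < p → p • β - q • P.root j ∈ Set.range P.root →
      p • β - q • P.root j ∈ S)
    (hc : wordProd b (U ++ A) (P.root c) = P.root j)
    (hx : -wordProd b (U ++ A) (P.root x) ∈ S) :
    ∀ t ≤ k, ∃ A' : List b.support, A'.length + t = A.length ∧
      wordProd b (A' ++ (altWord t x c).reverse) = wordProd b A := by
  obtain ⟨-, halt, -⟩ := posWord_altWord_and_wordProd_eq hcx
  have hlast := altWord_last_root hcx hk
  rw [hk] at halt
  intro t
  induction t with
  | zero => exact fun _ => ⟨A, by simp⟩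
  | succ t ih =>
    intro ht
    obtain ⟨A', hl, he⟩ := ih (by omega)
    obtain ⟨r, rfl⟩ := Nat.exists_eq_add_of_le ht
    obtain ⟨v, hv⟩ := altWord_add (t + 1) r x c
    obtain ⟨hp', -⟩ := hpos.block_perm he (by simp [hl])
    have hp'' : PosWord b (U ++ A') := by
      rw [← List.append_assoc] at hp'
      exact hp'.of_append
    set z := altLetter t x c with hz
    set ρ := wordProd b (altWord t x c) (P.root z) with hρ
    have hρmem : ρ ∈ rootSeq b (altWord (t + 1 + r) x c) := by
      rw [hv, altWord_concat, rootSeq_append, rootSeq_concat]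
      simp [hρ, hz]
    have hρpos : IsPosRoot b ρ := by
      apply halt
      rw [altWord_concat (t + 1 + r), rootSeq_append]
      exact List.mem_append_left _ hρmem
    -- `α_c` is the last root of the full braid block and `ρ` an earlier one; this forces the
    -- coefficient of `α_x` in `ρ` to be positive.
    have hρne : ρ ≠ P.root c := by
      have := halt.nodup
      rw [altWord_concat (t + 1 + r), rootSeq_concat, hlast, List.nodup_append] at this
      exact this.2.2 _ hρmem _ (by simp)
    have hρz : ∀ i, i ≠ x → i ≠ c → b.toWeightBasis.repr ρ i = 0 := by
      intro i hix hic
      rw [hρ, repr_wordProd_of_notMem _ _ (fun h => (mem_altWord h).elim hix hic),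
        b.toWeightBasis_repr_root, Finsupp.single_eq_of_ne]
      rintro rfl
      rcases altLetter_cases t x c with h | h
      exacts [hix (hz.trans h.1), hic (hz.trans h.1)]
    have hsum := eq_smul_add_smul hcx hρz
    set p := b.toWeightBasis.repr ρ x with hp
    set q := b.toWeightBasis.repr ρ c with hq
    have hp0 : 0 < p := by
      refine lt_of_le_of_ne (hρpos.repr_nonneg x) fun h0 => hρne ?_
      rw [← h0, zero_smul, zero_add] at hsum
      exact eq_of_eq_smul hρpos (isPosRoot_root c) hsum
    have hUA : wordProd b (U ++ A') (P.root z) = wordProd b (U ++ A) ρ := by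
      rw [wordProd_append U A, ← he, wordProd_append A', wordProd_reverse, wordProd_append]
      simp only [LinearEquiv.mul_apply]
      rw [hρ, linearEquiv_inv_apply_self]
    have hneg : -wordProd b (U ++ A') (P.root z) =
        p • (-wordProd b (U ++ A) (P.root x)) - q • P.root j := by
      rw [hUA, hsum, map_add, map_smul, map_smul, hc]
      module
    have hinS : -wordProd b (U ++ A') (P.root z) ∈ S := by
      rw [hneg]
      apply hS _ hx _ _ hp0
      rw [← hneg]
      exact range_root_neg.2 (wordProd_root_mem _ ⟨_, rfl⟩)
    have hmem := hp''.neg_mem_rootSeq (hSpos _ hinS)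
    rw [rootSeq_append, List.mem_append] at hmem
    -- The inversion lies in `S`, which contains no root of `U`, so the deleted letter belongs to
    -- the second factor and `U` stays intact.
    obtain ⟨y, hy, hyx⟩ := List.mem_map.1 (hmem.resolve_left fun h => hUS _ h hinS)
    obtain ⟨A₁, a, A₂, rfl, rfl⟩ := exists_split_of_mem_rootSeq hy
    have hdel := wordProd_delete (b := b) (U ++ A₁) A₂ a z (.inr (by
      rw [List.append_assoc, wordProd_append U A₁, LinearEquiv.mul_apply, hyx, neg_neg]))
    refine ⟨A₁ ++ A₂, ?_, ?_⟩
    · simp at hl ⊢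
      omega
    · have h3 : wordProd b (A₁ ++ A₂) = wordProd b (A₁ ++ a :: A₂) * P.reflection z := by
        rw [List.append_assoc, List.append_assoc, wordProd_append U, wordProd_append U,
          mul_assoc] at hdel
        exact mul_left_cancel hdel
      rw [altWord_concat, List.reverse_append, wordProd_append, h3, ← he]
      simp only [List.reverse_cons, List.reverse_nil, List.nil_append, wordProd_append,
        wordProd_cons, wordProd_nil, mul_one, mul_assoc]
      rw [← mul_assoc (P.reflection (z : ι)) (P.reflection z), reflection_mul_self, one_mul]

/-- In a braidless region, a simple root moves to the left of a block by allowed moves. -/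
lemma IsBraidlessRegion.exists_move {Y : Set (M ≃ₗ[K] M)} {S : Set M}
    (hYS : IsBraidlessRegion (b := b) Y S) {j : b.support} {U : List b.support}
    (hSpos : ∀ β ∈ S, IsPosRoot b β) (hUS : ∀ β ∈ rootSeq b U, β ∉ S)
    (hS : ∀ β ∈ S, ∀ p q : K, 0 < p → p • β - q • P.root j ∈ Set.range P.root →
      p • β - q • P.root j ∈ S)
    (hU : wordProd b U ∈ Y) (A : List b.support) (c : b.support) (V : List b.support)
    (hpos : PosWord b (U ++ A)) (hA : ∀ x ∈ (rootSeq b A).map (wordProd b U), x ∈ S)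
    (hc : wordProd b (U ++ A) (P.root c) = P.root j) :
    ∃ (c' : b.support) (V' : List b.support),
      Relation.ReflTransGen (AllowedMove b j) (U ++ A ++ c :: V) (U ++ c' :: V') ∧
      wordProd b U (P.root c') = P.root j := by
  induction hn : A.length using Nat.strongRecOn generalizing A c V with
  | ind n ih =>
    rcases List.eq_nil_or_concat A with rfl | ⟨B, x, hB⟩
    · exact ⟨c, V, by simpa using .refl, by simpa using hc⟩
    rw [List.concat_eq_append] at hB
    subst hB
    have hxneg : -wordProd b (U ++ (B ++ [x])) (P.root x) = wordProd b U (wordProd b B (P.root x)) := by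
      simp
    have hxS : -wordProd b (U ++ (B ++ [x])) (P.root x) ∈ S := by
      rw [hxneg]
      exact hA _ (by simp [rootSeq_append])
    have hxc : x ≠ c := by
      rintro rfl
      rw [hc] at hxS
      exact (isPosRoot_root j).not_neg (hSpos _ hxS)
    obtain ⟨hm, -, -⟩ := posWord_altWord_and_wordProd_eq hxc
    obtain ⟨k, hk⟩ := Nat.exists_eq_add_of_lt hm
    rw [zero_add] at hk
    have hk0 : 0 < k := by
      by_contra h
      have := altWord_last_root hxc hk
      obtain rfl : k = 0 := by omega
      exact hxc (root_injective (by simpa using this))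
    -- All of the braid block except its last letter `c` is collected at the end of `A`; reaching
    -- this form costs only 2-term moves.
    obtain ⟨A', hl, he⟩ := exists_strip_altWord hpos hxc hk hSpos hUS hS hc hxS k le_rfl
    have hl' : (A' ++ (altWord k x c).reverse).length = (B ++ [x]).length := by
      simpa using hl
    obtain ⟨hp', hperm⟩ := hpos.block_perm he hl'.le
    have hmove := hYS.reflTransGen j (c :: V) U (B ++ [x]) _ hU hpos hA he hl'
    have hrev : (altWord k x c).reverse ++ [c] =
        altWord (k + 1) (altLetter k c x) (altLetter k x c) := by
      rw [← reverse_altWord, altWord_succ, List.reverse_cons]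
    have hord : altLetter k c x ≠ altLetter k x c ∧
        braidOrder b (altLetter k c x) (altLetter k x c) = k + 1 := by
      rcases altLetter_cases k x c with h | h <;> rw [h.1, h.2]
      · exact ⟨hxc.symm, by rw [braidOrder_comm, hk]⟩
      · exact ⟨hxc, hk⟩
    have hc' : wordProd b (U ++ (A' ++ (altWord k x c).reverse)) (P.root c) = P.root j := by
      rw [← hc, wordProd_append U, he, ← wordProd_append]
    -- After the braid move the root `α_j` sits at the first letter of the block, so the induction
    -- continues with the shorter `A'`.
    have hc'' : wordProd b (U ++ A') (P.root (altLetter (B := b.support) k x c)) = P.root j := by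
      rw [← hc', ← altWord_last_root hxc hk, ← List.append_assoc, wordProd_append (U ++ A'),
        wordProd_reverse, LinearEquiv.mul_apply, linearEquiv_inv_apply_self]
    obtain ⟨c', V', h1, h2⟩ := ih A'.length (by omega) A' (altLetter k x c)
      (altWord k (altLetter k c x) (altLetter k x c) ++ V)
      (by rw [← List.append_assoc] at hp'; exact hp'.of_append)
      (fun y hy => hA y (hperm.subset (by
        rw [rootSeq_append, List.map_append]
        exact List.mem_append_left _ hy)))
      hc'' rfl
    refine ⟨c', V', hmove.trans (.head ?_ h1), h2⟩
    refine ⟨U ++ A', V, altLetter k c x, altLetter k x c, hord.1, ?_, ?_, .inr ?_⟩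
    · rw [hord.2, ← hrev]
      simp
    · rw [hord.2, altWord_succ]
      simp
    · rw [hord.2, ← hrev, ← List.append_assoc, rootSeq_concat, List.getLast?_concat,
        List.append_assoc, hc']

/-! ### Convex orders and reduced words of the longest element. -/

section Convex

variable {Γ : Type*} [LinearOrder Γ] {f : M → Γ}

/-- The initial section property: the word `l` lists an initial section of the positive roots with
respect to `f`, in increasing order. -/
structure IsInitialWord (b : P.Base) (f : M → Γ) (l : List b.support) : Prop where
  posWord : PosWord b l
  pairwise : (rootSeq b l).Pairwise fun x y => f x < f y
  lt_of_notMem : ∀ x ∈ rootSeq b l, ∀ y, IsPosRoot b y → y ∉ rootSeq b l → f x < f y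

lemma IsInitialWord.exists_concat
    (hinj : ∀ x y, IsPosRoot b x → IsPosRoot b y → f x = f y → x = y)
    (hconv : ∀ x y, IsPosRoot b x → IsPosRoot b y → IsPosRoot b (x + y) → f x < f y →
      f x < f (x + y) ∧ f (x + y) < f y)
    {l : List b.support} (hl : IsInitialWord b f l) {z : M} (hz : IsPosRoot b z)
    (hzl : z ∉ rootSeq b l) : ∃ i, IsInitialWord b f (l ++ [i]) := by
  classical
  have := Fintype.ofFinite ι
  let s : Finset M := (Finset.univ.image P.root).filter fun x => IsPosRoot b x ∧ x ∉ rootSeq b l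
  have hs : ∀ x, x ∈ s ↔ IsPosRoot b x ∧ x ∉ rootSeq b l := by
    intro x
    simp only [s, Finset.mem_filter, and_iff_right_iff_imp, and_imp, Finset.mem_image,
      Finset.mem_univ, true_and]
    exact fun h _ => h.mem_range
  -- The next root must be the smallest one not yet listed; convexity will show that its preimage
  -- under the current element is simple.
  obtain ⟨β, hβs, hmin⟩ := s.exists_min_image f ⟨z, (hs z).2 ⟨hz, hzl⟩⟩
  obtain ⟨hβ, hβl⟩ := (hs β).1 hβs
  have hmin' : ∀ x, IsPosRoot b x → x ∉ rootSeq b l → x ≠ β → f β < f x := fun x hx hxl hne =>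
    lt_of_le_of_ne (hmin x ((hs x).2 ⟨hx, hxl⟩)) fun e => hne (hinj _ _ hβ hx e).symm
  have hγ : IsPosRoot b ((wordProd b l)⁻¹ β) := by
    have := hl.posWord.mem_rootSeq_iff.not.1 hβl
    rw [isPosRoot_neg_iff (wordProd_inv_root_mem l hβ.mem_range)] at this
    by_contra h
    exact this ⟨hβ, h⟩
  have hnotMem : ∀ y, IsPosRoot b y → wordProd b l y ∉ rootSeq b l := by
    intro y hy h
    rw [hl.posWord.mem_rootSeq_iff, linearEquiv_inv_apply_self] at h
    exact hy.not_neg h.2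
  have hconv' : ∀ x y, IsPosRoot b x → IsPosRoot b y → IsPosRoot b (x + y) →
      (f x < f (x + y) ∧ f (x + y) < f y) ∨ (f y < f (x + y) ∧ f (x + y) < f x) := by
    intro x y hx hy hxy
    rcases lt_trichotomy (f x) (f y) with h | h | h
    · exact .inl (hconv x y hx hy hxy h)
    · obtain rfl := hinj _ _ hx hy h
      have := eq_of_eq_smul hxy hx (c := 2) (by module)
      obtain ⟨j, hj⟩ := hx.mem_range
      exact absurd (hj.trans (by simpa using this)) (P.ne_zero j)
    · rw [add_comm] at hxy ⊢
      exact .inr (hconv y x hy hx hxy h)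
  -- Suppose `β = w y + w z` with `w y` positive. If `w z` is positive too, `β` lies between two
  -- larger roots. Otherwise `-w z` is already listed, hence below `β`, and `w y = β + (-w z)` falls
  -- below `β`, against minimality.
  have key : ∀ y z, IsPosRoot b y → IsPosRoot b z → (wordProd b l)⁻¹ β = y + z →
      IsPosRoot b (wordProd b l y) → False := by
    intro y z hy hz e hwy
    have e' : β = wordProd b l y + wordProd b l z := by
      rw [← map_add, ← e, linearEquiv_apply_inv_self]
    have hz0 : wordProd b l z ≠ 0 := by
      obtain ⟨j, rfl⟩ := hz.mem_range
      exact fun h => P.ne_zero j ((wordProd b l).map_eq_zero_iff.1 h)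
    have hy0 : wordProd b l y ≠ 0 := by
      obtain ⟨j, rfl⟩ := hy.mem_range
      exact fun h => P.ne_zero j ((wordProd b l).map_eq_zero_iff.1 h)
    have hfy : f β < f (wordProd b l y) := hmin' _ hwy (hnotMem y hy) fun h => hz0 (by
      rw [h] at e'
      exact left_eq_add.1 e')
    rcases isPosRoot_or_neg (b := b) (wordProd_root_mem l hz.mem_range) with hwz | hwz
    · have hfz : f β < f (wordProd b l z) := hmin' _ hwz (hnotMem z hz) fun h => hy0 (by
        rw [h] at e'
        exact right_eq_add.1 e')
      rcases hconv' _ _ hwy hwz (e' ▸ hβ) with h | h <;> rw [← e'] at h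
      · exact lt_asymm h.1 hfy
      · exact lt_asymm h.1 hfz
    · have hmem : -wordProd b l z ∈ rootSeq b l := by
        rw [hl.posWord.mem_rootSeq_iff, map_neg, linearEquiv_inv_apply_self, neg_neg]
        exact ⟨hwz, hz⟩
      have hlt := hl.lt_of_notMem _ hmem β hβ hβl
      have e'' : wordProd b l y = β + -wordProd b l z := by
        rw [e']
        abel
      rcases hconv' _ _ hβ hwz (e'' ▸ hwy) with h | h <;> rw [← e''] at h
      · exact lt_asymm (h.1.trans h.2) hlt
      · exact lt_asymm h.2 hfy
  rcases hγ.simple_or_add with ⟨i, hi⟩ | ⟨y, z, hy, hz, e⟩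
  · have hβi : β = wordProd b l (P.root i) := by rw [← hi, linearEquiv_apply_inv_self]
    refine ⟨i, posWord_concat.2 ⟨hl.posWord, hβi ▸ hβ⟩, ?_, ?_⟩
    · rw [rootSeq_concat, List.pairwise_append, ← hβi]
      refine ⟨hl.pairwise, by simp, fun x hx y hy => ?_⟩
      rw [List.mem_singleton.1 hy]
      exact hl.lt_of_notMem x hx β hβ hβl
    · rw [rootSeq_concat, ← hβi]
      intro x hx y hy hyl
      simp only [List.mem_append, List.mem_singleton, not_or] at hx hyl
      rcases hx with hx | rfl
      · exact hl.lt_of_notMem x hx y hy hyl.1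
      · exact hmin' y hy hyl.1 hyl.2
  · exfalso
    rcases isPosRoot_or_neg (b := b) (wordProd_root_mem l hy.mem_range) with h | h
    · exact key y z hy hz e h
    rcases isPosRoot_or_neg (b := b) (wordProd_root_mem l hz.mem_range) with h' | h'
    · exact key z y hz hy (by rw [e, add_comm]) h'
    · have e' : -β = -wordProd b l y + -wordProd b l z := by
        rw [← neg_add, ← map_add, ← e, linearEquiv_apply_inv_self]
      have := h.add h' (e' ▸ range_root_neg.2 hβ.mem_range)
      rw [← e'] at this
      exact hβ.not_neg this

/-- A convex order on the positive roots comes from a reduced word of the longest element. -/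
lemma exists_isReducedLongWord_of_convex
    (hinj : ∀ x y, IsPosRoot b x → IsPosRoot b y → f x = f y → x = y)
    (hconv : ∀ x y, IsPosRoot b x → IsPosRoot b y → IsPosRoot b (x + y) → f x < f y →
      f x < f (x + y) ∧ f (x + y) < f y) :
    ∃ l, IsReducedLongWord b l ∧ (rootSeq b l).Pairwise fun x y => f x < f y := by
  have := Fintype.ofFinite ι
  suffices ∀ l, IsInitialWord b f l → ∃ l', IsInitialWord b f l' ∧
      ∀ x, IsPosRoot b x → x ∈ rootSeq b l' by
    obtain ⟨l, hl, hall⟩ := this [] ⟨by simp [PosWord], by simp, by simp⟩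
    exact ⟨l, isReducedLongWord_iff.2 ⟨hl.posWord, hall⟩, hl.pairwise⟩
  intro l
  induction h : Fintype.card ι - l.length using Nat.strongRecOn generalizing l with
  | ind n ih =>
    intro hl
    by_cases hall : ∀ x, IsPosRoot b x → x ∈ rootSeq b l
    · exact ⟨l, hl, hall⟩
    push Not at hall
    obtain ⟨z, hz, hzl⟩ := hall
    obtain ⟨i, hi⟩ := hl.exists_concat hinj hconv hz hzl
    have := hi.posWord.length_le
    simp only [List.length_append, List.length_singleton] at this
    exact ih _ (by simp only [List.length_append, List.length_singleton]; omega) _ rfl hi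

lemma eq_of_pairwise_lt {l l' : List b.support} (hl : IsReducedLongWord b l)
    (hl' : IsReducedLongWord b l') (h : (rootSeq b l).Pairwise fun x y => f x < f y)
    (h' : (rootSeq b l').Pairwise fun x y => f x < f y) : l = l' := by
  rw [isReducedLongWord_iff] at hl hl'
  apply rootSeq_injective (b := b)
  have hperm : (rootSeq b l).Perm (rootSeq b l') :=
    (List.perm_ext_iff_of_nodup hl.1.nodup hl'.1.nodup).2 fun x =>
      ⟨fun hx => hl'.2 x (hl.1 x hx), fun hx => hl.2 x (hl'.1 x hx)⟩
  exact hperm.eq_of_pairwise (fun x y _ _ h1 h2 => absurd (lt_trans h1 h2) (lt_irrefl _)) h h'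

end Convex

/-! ### The lexicographic order is total and convex on positive roots. -/

section Lex

variable {n : ℕ} {e : Fin n ≃ b.support}

lemma exists_isLeading {x : M} (hx : x ≠ 0) : ∃ k, IsLeading b e x k := by
  classical
  have hne : ((Finset.univ : Finset (Fin n)).filter fun k => coord b e x k ≠ 0).Nonempty := by
    by_contra hempty
    apply hx
    apply b.toWeightBasis.repr.injective
    ext i
    by_contra h
    refine hempty ⟨e.symm i, Finset.mem_filter.2 ⟨Finset.mem_univ _, ?_⟩⟩
    simpa [coord] using h
  refine ⟨_, (Finset.mem_filter.1 (Finset.min'_mem _ hne)).2, fun j hj => ?_⟩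
  by_contra h
  have hmem : j ∈ (Finset.univ : Finset (Fin n)).filter fun k => coord b e x k ≠ 0 :=
    Finset.mem_filter.2 ⟨Finset.mem_univ j, h⟩
  exact absurd hj (not_lt.2 (Finset.min'_le _ j hmem))

lemma IsLeading.unique {x : M} {k k' : Fin n} (h : IsLeading b e x k) (h' : IsLeading b e x k') :
    k = k' := by
  rcases lt_trichotomy k k' with hlt | heq | hlt
  · exact absurd (h'.2 k hlt) h.1
  · exact heq
  · exact absurd (h.2 k' hlt) h'.1

open Classical in
variable (b e) in
/-- The sort key of the lexicographic order: the leading index and the normalized coordinates. -/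
noncomputable def lexKey (x : M) : WithBot (Fin n ×ₗ Lex (Fin n → K)) :=
  if h : ∃ k, IsLeading b e x k then
    ((toLex (h.choose, toLex fun j => coord b e x j / coord b e x h.choose) :
      Fin n ×ₗ Lex (Fin n → K)) : WithBot _)
  else ⊥

lemma IsLeading.lexKey_eq {x : M} {k : Fin n} (h : IsLeading b e x k) :
    lexKey b e x = ((toLex (k, toLex fun j => coord b e x j / coord b e x k) :
      Fin n ×ₗ Lex (Fin n → K)) : WithBot _) := by
  have hex : ∃ k, IsLeading b e x k := ⟨k, h⟩
  rw [lexKey, dif_pos hex, hex.choose_spec.unique h]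

/-- Normalised coordinates are `0` before the leading index and `1` at it, so comparing the whole
tuples amounts to comparing the entries after the leading index. -/
lemma lexLT_iff {x y : M} {k k' : Fin n} (hx : IsLeading b e x k) (hy : IsLeading b e y k') :
    LexLT b e x y ↔ lexKey b e x < lexKey b e y := by
  rw [hx.lexKey_eq, hy.lexKey_eq, WithBot.coe_lt_coe, Prod.Lex.toLex_lt_toLex]
  constructor
  · rintro ⟨l, l', hl, hl', h⟩
    obtain rfl := hl.unique hx
    obtain rfl := hl'.unique hy
    refine h.imp_right ?_
    rintro ⟨rfl, m, hlm, heq, hlt⟩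
    refine ⟨rfl, m, fun j hj => ?_, hlt⟩
    rcases lt_trichotomy l j with h | rfl | h
    · exact heq j h hj
    · simp [div_self hx.1, div_self hy.1]
    · simp [hx.2 j h, hy.2 j h]
  · refine fun h => ⟨k, k', hx, hy, h.imp_right ?_⟩
    rintro ⟨h, m, heq, hlt⟩
    simp only at h
    subst h
    refine ⟨rfl, m, ?_, fun j _ hj => heq j hj, hlt⟩
    by_contra hkm
    rcases lt_or_eq_of_le (not_lt.1 hkm) with h | rfl
    · simp [hx.2 m h, hy.2 m h] at hlt
    · simp [div_self hx.1, div_self hy.1] at hlt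

lemma IsPosRoot.ne_zero {x : M} (h : IsPosRoot b x) : x ≠ 0 := by
  obtain ⟨j, _, rfl⟩ := h
  exact P.ne_zero j

lemma IsPosRoot.lexLT_iff {x y : M} (hx : IsPosRoot b x) (hy : IsPosRoot b y) :
    LexLT b e x y ↔ lexKey b e x < lexKey b e y := by
  obtain ⟨k, hk⟩ := exists_isLeading (e := e) hx.ne_zero
  obtain ⟨k', hk'⟩ := exists_isLeading (e := e) hy.ne_zero
  exact SimplyBraided.lexLT_iff hk hk'

lemma coord_add (x y : M) (k : Fin n) : coord b e (x + y) k = coord b e x k + coord b e y k := by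
  simp [coord]

lemma IsPosRoot.coord_nonneg {x : M} (h : IsPosRoot b x) (k : Fin n) : 0 ≤ coord b e x k :=
  h.repr_nonneg _

lemma IsLeading.pos {x : M} {k : Fin n} (h : IsLeading b e x k) (hx : IsPosRoot b x) :
    0 < coord b e x k :=
  lt_of_le_of_ne (hx.coord_nonneg k) h.1.symm

lemma lexKey_injective {x y : M} (hx : IsPosRoot b x) (hy : IsPosRoot b y)
    (h : lexKey b e x = lexKey b e y) : x = y := by
  obtain ⟨k, hk⟩ := exists_isLeading (e := e) hx.ne_zero
  obtain ⟨k', hk'⟩ := exists_isLeading (e := e) hy.ne_zero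
  rw [hk.lexKey_eq, hk'.lexKey_eq, WithBot.coe_inj, toLex_inj, Prod.mk.injEq, toLex_inj] at h
  obtain ⟨rfl, h⟩ := h
  refine eq_of_eq_smul hx hy (c := coord b e x k / coord b e y k) ?_
  apply b.toWeightBasis.repr.injective
  ext i
  have := congrFun h (e.symm i)
  rw [div_eq_div_iff hk.1 hk'.1] at this
  have h0 := hk'.1
  simp only [coord, Equiv.apply_symm_apply, map_smul, Finsupp.smul_apply, smul_eq_mul] at this h0 ⊢
  field_simp
  linarith

/-- For equal leading indices this is the mediant inequality. If `k < k'`, adding `y` to `x` leaves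
the coordinates before `k'` alone and raises the one at `k'`. -/
lemma lexKey_convex {x y : M} (hx : IsPosRoot b x) (hy : IsPosRoot b y)
    (hxy : IsPosRoot b (x + y)) (h : lexKey b e x < lexKey b e y) :
    lexKey b e x < lexKey b e (x + y) ∧ lexKey b e (x + y) < lexKey b e y := by
  rw [← hx.lexLT_iff hy] at h
  rw [← hx.lexLT_iff hxy, ← hxy.lexLT_iff hy]
  obtain ⟨k, k', hk, hk', h⟩ := h
  have hxk := hk.pos hx
  have hyk := hk'.pos hy
  rcases h with h | ⟨rfl, m, hkm, heq, hlt⟩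
  · have hlead : IsLeading b e (x + y) k := by
      refine ⟨?_, fun j hj => ?_⟩
      · rw [coord_add, hk'.2 k h, add_zero]
        exact hk.1
      · rw [coord_add, hk.2 j hj, hk'.2 j (hj.trans h), add_zero]
    refine ⟨⟨k, k, hk, hlead, .inr ⟨rfl, k', h, fun j _ hj => ?_, ?_⟩⟩,
      ⟨k, k', hlead, hk', .inl h⟩⟩
    · rw [coord_add, coord_add, hk'.2 j hj, hk'.2 k h, add_zero, add_zero]
    · rw [coord_add, coord_add, hk'.2 k h, add_zero]
      gcongr
      linarith
  · have hlead : IsLeading b e (x + y) k := by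
      refine ⟨?_, fun j hj => ?_⟩
      · rw [coord_add]
        positivity
      · rw [coord_add, hk.2 j hj, hk'.2 j hj, add_zero]
    rw [div_lt_div_iff₀ hxk hyk] at hlt
    refine ⟨⟨k, k, hk, hlead, .inr ⟨rfl, m, hkm, fun j hj hjm => ?_, ?_⟩⟩,
      ⟨k, k, hlead, hk', .inr ⟨rfl, m, hkm, fun j hj hjm => ?_, ?_⟩⟩⟩
    · have := heq j hj hjm
      rw [div_eq_div_iff hxk.ne' hyk.ne'] at this
      rw [coord_add, coord_add, div_eq_div_iff hxk.ne' (by positivity)]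
      linarith
    · rw [coord_add, coord_add, div_lt_div_iff₀ hxk (by positivity)]
      linarith
    · have := heq j hj hjm
      rw [div_eq_div_iff hxk.ne' hyk.ne'] at this
      rw [coord_add, coord_add, div_eq_div_iff (by positivity) hyk.ne']
      linarith
    · rw [coord_add, coord_add, div_lt_div_iff₀ (by positivity) hyk]
      linarith

lemma isLexWord_iff {l : List b.support} : IsLexWord b e l ↔
    IsReducedLongWord b l ∧ (rootSeq b l).Pairwise fun x y => lexKey b e x < lexKey b e y := by
  refine and_congr_right fun h => List.Pairwise.iff_of_mem fun hx hy => ?_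
  exact ((isReducedLongWord_iff.1 h).1 _ hx).lexLT_iff ((isReducedLongWord_iff.1 h).1 _ hy)

/-- Every enumeration has exactly one associated reduced word of the longest element. -/
lemma existsUnique_isLexWord (e : Fin n ≃ b.support) : ∃! l : List b.support, IsLexWord b e l := by
  simp only [isLexWord_iff]
  obtain ⟨l, hl, hl'⟩ := exists_isReducedLongWord_of_convex (b := b) (f := lexKey b e)
    (fun _ _ => lexKey_injective) (fun _ _ => lexKey_convex)
  exact ⟨l, ⟨hl, hl'⟩, fun l' h => eq_of_pairwise_lt h.1 hl h.2 hl'⟩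

end Lex

/-! ### The invariant form, fundamental weights and parabolic subgroups. -/

section Form

variable [Fintype ι]

/-- Translates signs of coroot pairings into signs of the invariant form and back. -/
lemma two_mul_rootForm (v : M) (i : ι) :
    2 * P.RootForm v (P.root i) = P.coroot' i v * P.RootForm (P.root i) (P.root i) := by
  have h := P.rootForm_reflection_reflection_apply i v (P.root i)
  rw [P.reflection_apply, P.reflection_apply_self, map_neg, map_sub, map_smul,
    LinearMap.sub_apply, LinearMap.smul_apply, smul_eq_mul] at h
  linarith

lemma rootForm_root_pos (i : ι) : 0 < P.RootForm (P.root i) (P.root i) := by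
  rw [P.rootForm_root_self]
  refine Finset.sum_pos' (fun j _ => mul_self_nonneg _) ⟨i, Finset.mem_univ _, ?_⟩
  rw [P.pairing_same]
  norm_num

lemma eq_zero_of_rootForm_self {v : M} (h : P.RootForm v v = 0) : v = 0 := by
  rw [P.rootForm_apply_apply, Finset.sum_eq_zero_iff_of_nonneg fun i _ => mul_self_nonneg _] at h
  refine P.rootForm_nondegenerate.1 v fun w => ?_
  rw [P.rootForm_apply_apply]
  exact Finset.sum_eq_zero fun i hi => by rw [mul_self_eq_zero.1 (h i hi), zero_mul]

lemma rootForm_wordProd (l : List b.support) (v w : M) :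
    P.RootForm (wordProd b l v) (wordProd b l w) = P.RootForm v w := by
  induction l with
  | nil => rfl
  | cons i l ih =>
    rw [wordProd_cons, LinearEquiv.mul_apply, LinearEquiv.mul_apply,
      P.rootForm_reflection_reflection_apply, ih]

end Form

/-- Fundamental weights exist. -/
lemma exists_isFundamentalWeight (J : Set b.support) {i : b.support} (hi : i ∈ J) :
    ∃ ω, IsFundamentalWeight b J i ω := by
  classical
  have := Fintype.ofFinite ι
  let S : (J → K) →ₗ[K] M := Fintype.linearCombination K fun j : J => P.root (j : b.support)
  let T : (J → K) →ₗ[K] (J → K) := LinearMap.pi fun j => P.coroot' (j : b.support) ∘ₗ S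
  have hS : ∀ c : J → K, S c = ∑ j : J, c j • P.root (j : b.support) := fun c => by
    simp [S, Fintype.linearCombination_apply]
  -- A vector in the span of the simple roots of `J` that is killed by their coroots is orthogonal
  -- to itself, hence zero by definiteness of the form; injectivity then gives surjectivity.
  have hinj : Function.Injective T := by
    rw [← LinearMap.ker_eq_bot, LinearMap.ker_eq_bot']
    intro c hc
    have h0 : P.RootForm (S c) (S c) = 0 := by
      conv_lhs => rw [hS c, map_sum, ← hS c]
      refine Finset.sum_eq_zero fun j _ => ?_
      have h1 := two_mul_rootForm (P := P) (S c) (j : b.support).1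
      have h2 : P.coroot' (j : b.support) (S c) = 0 := congrFun hc j
      rw [h2, zero_mul] at h1
      rw [map_smul, (mul_eq_zero.1 h1).resolve_left two_ne_zero, smul_zero]
    have h1 := eq_zero_of_rootForm_self (P := P) h0
    rw [hS] at h1
    have hli : LinearIndependent K fun j : J => P.root (j : b.support) := by
      have := b.toWeightBasis.linearIndependent.comp (fun j : J => (j : b.support))
        Subtype.val_injective
      simpa [Function.comp_def] using this
    exact funext (Fintype.linearIndependent_iff.1 hli c h1)
  obtain ⟨c, hc⟩ := (LinearMap.injective_iff_surjective.1 hinj) (Pi.single ⟨i, hi⟩ 1)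
  refine ⟨S c, ?_, ?_, fun j hj hji => ?_⟩
  · rw [hS]
    exact Submodule.sum_mem _ fun j _ => Submodule.smul_mem _ _
      (Submodule.subset_span ⟨j, j.2, rfl⟩)
  · have := congrFun hc ⟨i, hi⟩
    simpa [T] using this
  · have := congrFun hc ⟨j, hj⟩
    rw [Pi.single_eq_of_ne (fun h => hji (congrArg Subtype.val h))] at this
    simpa [T] using this

lemma exists_wordProd_of_mem_parabolic {J : Set b.support} {τ : M ≃ₗ[K] M}
    (h : τ ∈ parabolic b J) : ∃ l : List b.support, (∀ i ∈ l, i ∈ J) ∧ wordProd b l = τ := by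
  unfold parabolic at h
  induction h using Subgroup.closure_induction with
  | mem x hx =>
    obtain ⟨j, hj, rfl⟩ := hx
    exact ⟨[j], by simpa using hj, by simp⟩
  | one => exact ⟨[], by simp, rfl⟩
  | mul x y _ _ hx hy =>
    obtain ⟨l, hl, rfl⟩ := hx
    obtain ⟨l', hl', rfl⟩ := hy
    refine ⟨l ++ l', fun i hi => ?_, wordProd_append _ _⟩
    exact (List.mem_append.1 hi).elim (hl i) (hl' i)
  | inv x _ hx =>
    obtain ⟨l, hl, rfl⟩ := hx
    exact ⟨l.reverse, fun i hi => hl i (List.mem_reverse.1 hi), wordProd_reverse l⟩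

lemma not_isPosRoot_add_eq_root {y z : M} (hy : IsPosRoot b y) (hz : IsPosRoot b z)
    (i : b.support) : y + z ≠ P.root i := by
  classical
  intro h
  have hcoord : ∀ k, k ≠ i → b.toWeightBasis.repr y k = 0 := by
    intro k hk
    have h1 := DFunLike.congr_fun (congrArg b.toWeightBasis.repr h) k
    rw [map_add, b.toWeightBasis_repr_root, Finsupp.add_apply, Finsupp.single_eq_of_ne hk] at h1
    linarith [hy.repr_nonneg k, hz.repr_nonneg k]
  have hyi : y = b.toWeightBasis.repr y i • P.root i := by
    apply b.toWeightBasis.repr.injective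
    ext k
    rw [map_smul, b.toWeightBasis_repr_root, Finsupp.smul_apply]
    by_cases hk : k = i
    · subst hk
      simp
    · rw [Finsupp.single_eq_of_ne hk, hcoord k hk, smul_zero]
  have := eq_of_eq_smul hy (isPosRoot_root i) hyi
  rw [this, add_eq_left] at h
  exact hz.ne_zero h

lemma braidOrder_eq_two {d e : b.support} (hde : d ≠ e)
    (h : Commute (P.reflection d) (P.reflection e)) : braidOrder b d e = 2 := by
  have : Fact (Nat.Prime 2) := ⟨Nat.prime_two⟩
  refine orderOf_eq_prime ?_ fun h1 => ?_
  · rw [h.mul_pow, P.reflection_sq, P.reflection_sq, one_mul]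
  · have := altWord_last_root hde (k := 0) (by rw [braidOrder, h1, orderOf_one])
    exact hde (root_injective (by simpa using this))

/-! ### Good enumerations give simply braided words. -/

section Enumeration

variable {n : ℕ} {e : Fin n ≃ b.support}

variable (e) in
/-- Some coordinate of `x` with index smaller than `m` is nonzero. -/
def HasLowCoord (m : ℕ) (x : M) : Prop := ∃ j : Fin n, (j : ℕ) < m ∧ coord b e x j ≠ 0

variable (e) in
/-- The positive roots with leading index `m`. -/
def leadingRoots (m : Fin n) : Set M :=
  {x | IsPosRoot b x ∧ ¬ HasLowCoord e m x ∧ coord b e x m ≠ 0}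

lemma coord_root (i j : Fin n) : coord b e (P.root (e i)) j = if i = j then 1 else 0 := by
  classical
  rw [coord, b.toWeightBasis_repr_root, Finsupp.single_apply]
  simp

lemma coord_smul (c : K) (x : M) (k : Fin n) : coord b e (c • x) k = c * coord b e x k := by
  simp [coord]

lemma coord_neg (x : M) (k : Fin n) : coord b e (-x) k = -coord b e x k := by
  simp [coord]

lemma eq_sum_coord (x : M) : x = ∑ k, coord b e x k • P.root (e k) := by
  conv_lhs => rw [← b.toWeightBasis.sum_repr x]
  rw [← e.sum_comp]
  simp [coord]

lemma coord_wordProd {m : ℕ} {l : List b.support} (hl : ∀ i ∈ l, i ∈ e '' {k | m ≤ (k : ℕ)})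
    (x : M) {j : Fin n} (hj : (j : ℕ) < m) : coord b e (wordProd b l x) j = coord b e x j := by
  refine repr_wordProd_of_notMem l (e j) (fun h => ?_) x
  obtain ⟨k, hk, hkj⟩ := hl _ h
  obtain rfl := e.injective hkj
  exact absurd hj (not_lt.2 hk)

lemma hasLowCoord_wordProd {m : ℕ} {l : List b.support}
    (hl : ∀ i ∈ l, i ∈ e '' {k | m ≤ (k : ℕ)}) (x : M) :
    HasLowCoord e m (wordProd b l x) ↔ HasLowCoord e m x :=
  exists_congr fun _ => and_congr_right fun hj => by rw [coord_wordProd hl x hj]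

lemma hasLowCoord_neg {m : ℕ} (x : M) : HasLowCoord e m (-x) ↔ HasLowCoord e m x := by
  simp [HasLowCoord, coord_neg]

/-- The element that inverts exactly the positive roots with leading index smaller than `m` maps
simple roots to simple roots of the standard parabolic subsystem, if it maps them there at all. -/
lemma exists_eq_root_of_not_hasLowCoord {U : List b.support} {m : ℕ} (hpos : PosWord b U)
    (hU : ∀ x, IsPosRoot b x → (x ∈ rootSeq b U ↔ HasLowCoord e m x)) {d : b.support}
    (hd : ¬ HasLowCoord e m (wordProd b U (P.root d))) :
    ∃ j : Fin n, m ≤ (j : ℕ) ∧ wordProd b U (P.root d) = P.root (e j) := by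
  have hinv : ∀ x, IsPosRoot b x → ¬ HasLowCoord e m x → IsPosRoot b ((wordProd b U)⁻¹ x) := by
    intro x hx hlow
    rw [← hU x hx, hpos.mem_rootSeq_iff,
      isPosRoot_neg_iff (wordProd_inv_root_mem U hx.mem_range)] at hlow
    by_contra h
    exact hlow ⟨hx, h⟩
  have hdpos : IsPosRoot b (wordProd b U (P.root d)) := by
    refine (isPosRoot_or_neg (wordProd_root_mem U ⟨_, rfl⟩)).resolve_right fun h => ?_
    have := hinv _ h (by rwa [hasLowCoord_neg])
    rw [map_neg, linearEquiv_inv_apply_self] at this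
    exact (isPosRoot_root d).not_neg this
  rcases hdpos.simple_or_add with ⟨i, hi⟩ | ⟨y, z, hy, hz, h⟩
  · obtain ⟨j, rfl⟩ := e.surjective i
    refine ⟨j, ?_, hi⟩
    by_contra hj
    exact hd ⟨j, not_le.1 hj, by simp [hi, coord_root]⟩
  -- If the image were a sum `y + z`, neither summand could have a low coordinate, so both would
  -- pull back to positive roots whose sum is the simple root `α_d`.
  · exfalso
    have hzero : ∀ j : Fin n, (j : ℕ) < m → coord b e y j = 0 ∧ coord b e z j = 0 := by
      intro j hj
      have h0 : coord b e (wordProd b U (P.root d)) j = 0 := by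
        by_contra h
        exact hd ⟨j, hj, h⟩
      rw [h, coord_add] at h0
      constructor <;> linarith [hy.coord_nonneg (e := e) j, hz.coord_nonneg (e := e) j]
    have h1 := hinv y hy fun ⟨j, hj, h⟩ => h (hzero j hj).1
    have h2 := hinv z hz fun ⟨j, hj, h⟩ => h (hzero j hj).2
    refine not_isPosRoot_add_eq_root h1 h2 d ?_
    rw [← map_add, ← h, linearEquiv_inv_apply_self]

/-- Only the coordinate at `m` contributes: those below it vanish, and `ω` is orthogonal to the
simple roots above it. -/
lemma IsFundamentalWeight.rootForm_pos [Fintype ι] {m : Fin n} {ω : M}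
    (hω : IsFundamentalWeight b (e '' Set.Ici m) (e m) ω) {β : M} (hβ : β ∈ leadingRoots e m) :
    0 < P.RootForm ω β := by
  rw [eq_sum_coord (e := e) β, map_sum, Finset.sum_eq_single m]
  · rw [map_smul, smul_eq_mul]
    have h1 := two_mul_rootForm (P := P) ω (e m)
    rw [hω.2.1, one_mul] at h1
    have h2 : 0 < coord b e β m := lt_of_le_of_ne (hβ.1.coord_nonneg m) hβ.2.2.symm
    have h3 := rootForm_root_pos (P := P) (e m)
    exact mul_pos h2 (by linarith)
  · intro k _ hkm
    rw [map_smul, smul_eq_mul]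
    rcases lt_or_gt_of_ne hkm with h | h
    · have : coord b e β k = 0 := by
        by_contra h'
        exact hβ.2.1 ⟨k, h, h'⟩
      rw [this, zero_mul]
    · have h1 := two_mul_rootForm (P := P) ω (e k)
      rw [hω.2.2 (e k) ⟨k, h.le, rfl⟩ (fun h' => hkm (e.injective h')), zero_mul] at h1
      rw [(mul_eq_zero.1 h1).resolve_left two_ne_zero, mul_zero]
  · simp

/-- Elements of `W_J` leave the coordinates below `m` unchanged, so a crossing of the block at `τ u`
comes from a `d` with `u α_d = α_j` simple in `J`. Then `(ω, τ α_j) > 0` gives `⟨α_j^∨, τ⁻¹ ω⟩ > 0`.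
For two crossings braidlessness yields orthogonality, and conjugating back by `u` yields commuting
simple reflections. -/
lemma isBraidlessRegion_leadingRoots {m : Fin n} (hm : IsBraidless b (e '' Set.Ici m) (e m))
    {U : List b.support} (hpos : PosWord b U)
    (hU : ∀ x, IsPosRoot b x → (x ∈ rootSeq b U ↔ HasLowCoord e m x)) :
    IsBraidlessRegion (b := b)
      ((fun τ => τ * wordProd b U) '' (parabolic b (e '' Set.Ici m) : Set (M ≃ₗ[K] M)))
      (leadingRoots e m) := by
  have := Fintype.ofFinite ι
  have hsimple : ∀ τ ∈ parabolic b (e '' Set.Ici m), ∀ d : b.support,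
      (τ * wordProd b U) (P.root d) ∈ leadingRoots e m →
      ∃ j : Fin n, m ≤ j ∧ wordProd b U (P.root d) = P.root (e j) := by
    intro τ hτ d hd
    obtain ⟨l, hl, rfl⟩ := exists_wordProd_of_mem_parabolic hτ
    refine exists_eq_root_of_not_hasLowCoord hpos hU ?_
    rw [← hasLowCoord_wordProd (l := l) hl]
    exact hd.2.1
  constructor
  · rintro - ⟨τ, hτ, rfl⟩ d hd
    obtain ⟨j, hj, h⟩ := hsimple τ hτ d hd
    refine ⟨τ * P.reflection (e j), mul_mem hτ (Subgroup.subset_closure ⟨e j, ⟨j, hj, rfl⟩, rfl⟩), ?_⟩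
    have h1 := wordProd_mul_reflection_comm (b := b) U [] d (e j) (.inl (by simpa using h))
    rw [wordProd_nil, one_mul, inv_one, mul_one, mul_inv_eq_iff_eq_mul] at h1
    simp only [mul_assoc, h1]
  · rintro - ⟨τ, hτ, rfl⟩ d d' hne hd hd'
    obtain ⟨j, hj, h⟩ := hsimple τ hτ d hd
    obtain ⟨k, hk, h'⟩ := hsimple τ hτ d' hd'
    have hjk : e j ≠ e k := fun hjk => hne (root_injective ((wordProd b U).injective (by
      rw [h, h', hjk])))
    obtain ⟨ω, hω⟩ := exists_isFundamentalWeight (b := b) (e '' Set.Ici m) (i := e m)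
      ⟨m, Set.self_mem_Ici, rfl⟩
    obtain ⟨l, hl, rfl⟩ := exists_wordProd_of_mem_parabolic hτ
    have hcoroot : ∀ i : Fin n, wordProd b l (P.root (e i)) ∈ leadingRoots e m →
        0 < P.coroot' (e i) ((wordProd b l)⁻¹ ω) := by
      intro i hi
      have h1 := hω.rootForm_pos hi
      rw [← linearEquiv_apply_inv_self (wordProd b l) ω, rootForm_wordProd] at h1
      have h2 := two_mul_rootForm (P := P) ((wordProd b l)⁻¹ ω) (e i)
      have h3 := rootForm_root_pos (P := P) (e i)
      by_contra h4
      have := mul_nonpos_of_nonpos_of_nonneg (not_lt.1 h4) h3.le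
      linarith
    have h0 := hm ω hω _ (inv_mem hτ) (e j) ⟨j, hj, rfl⟩ (e k) ⟨k, hk, rfl⟩ hjk
      (hcoroot j (by rwa [← h])) (hcoroot k (by rwa [← h']))
    rw [P.root_coroot'_eq_pairing] at h0
    have hcomm : Commute (P.reflection (e j)) (P.reflection (e k)) :=
      P.isOrthogonal_comm _ _ ⟨P.pairing_eq_zero_iff.1 h0, h0⟩
    apply braidOrder_eq_two hne
    have h1 := wordProd_mul_reflection_comm (b := b) U [] d (e j) (.inl (by simpa using h))
    have h2 := wordProd_mul_reflection_comm (b := b) U [] d' (e k) (.inl (by simpa using h'))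
    simp only [wordProd_nil, one_mul, inv_one, mul_one] at h1 h2
    rw [← h1, ← h2] at hcomm
    exact (Commute.conj_iff _).1 hcomm

lemma exists_append_of_pairwise {α : Type*} {R : α → α → Prop} {p : α → Prop}
    (hRp : ∀ x y, R x y → p y → p x) {L : List α} (h : L.Pairwise R) :
    ∃ L₁ L₂, L = L₁ ++ L₂ ∧ (∀ x ∈ L₁, p x) ∧ ∀ x ∈ L₂, ¬ p x := by
  induction L with
  | nil => exact ⟨[], [], by simp⟩
  | cons a L ih =>
    rw [List.pairwise_cons] at h
    by_cases ha : p a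
    · obtain ⟨L₁, L₂, rfl, h1, h2⟩ := ih h.2
      exact ⟨a :: L₁, L₂, rfl, List.forall_mem_cons.2 ⟨ha, h1⟩, h2⟩
    · exact ⟨[], a :: L, rfl, by simp, List.forall_mem_cons.2
        ⟨ha, fun x hx hpx => ha (hRp a x (h.1 x hx) hpx)⟩⟩

lemma LexLT.hasLowCoord {m : ℕ} {x y : M} (h : LexLT b e x y) (hy : HasLowCoord e m y) :
    HasLowCoord e m x := by
  obtain ⟨k, k', hk, hk', h⟩ := h
  obtain ⟨j, hj, hyj⟩ := hy
  have h1 : k ≤ k' := h.elim le_of_lt fun h => h.1.le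
  have h2 : k' ≤ j := not_lt.1 fun h => hyj (hk'.2 j h)
  exact ⟨k, lt_of_le_of_lt (h1.trans h2) hj, hk.1⟩

lemma LexLT.asymm {x y : M} (hx : IsPosRoot b x) (hy : IsPosRoot b y) (h : LexLT b e x y) :
    ¬ LexLT b e y x := by
  rw [hx.lexLT_iff hy] at h
  rw [hy.lexLT_iff hx]
  exact lt_asymm h

lemma LexLT.irrefl {x : M} (hx : IsPosRoot b x) : ¬ LexLT b e x x := by
  rw [hx.lexLT_iff hx]
  exact lt_irrefl _

/-- The roots preceding the simple root with index `k` are those with smaller leading index. -/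
lemma lexLT_root_iff {x : M} (hx : IsPosRoot b x) (k : Fin n) :
    LexLT b e x (P.root (e k)) ↔ HasLowCoord e k x := by
  have hk : IsLeading b e (P.root (e k)) k :=
    ⟨by simp [coord_root], fun j hj => by simp [coord_root, hj.ne']⟩
  constructor
  · rintro ⟨l, l', hl, hl', h | ⟨rfl, m, hlm, -, h⟩⟩
    · obtain rfl := hl'.unique hk
      exact ⟨l, h, hl.1⟩
    · obtain rfl := hl'.unique hk
      have : 0 ≤ coord b e x m / coord b e x l :=
        div_nonneg (hx.coord_nonneg m) (hx.coord_nonneg l)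
      rw [coord_root (e := e) l m, if_neg hlm.ne, zero_div] at h
      linarith
  · rintro ⟨j, hj, hxj⟩
    obtain ⟨l, hl⟩ := exists_isLeading (e := e) hx.ne_zero
    have : l ≤ j := not_lt.1 fun h => hxj (hl.2 j h)
    exact ⟨l, k, hl, hk, .inl (lt_of_le_of_lt this hj)⟩

/-- The word of a good enumeration is simply braided. -/
lemma IsLexWord.isSimplyBraided (he : IsGoodEnumeration b e) {l : List b.support}
    (hl : IsLexWord b e l) : IsSimplyBraided b l := by
  intro i
  obtain ⟨k, rfl⟩ := e.surjective i
  obtain ⟨hlong, hsorted⟩ := hl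
  obtain ⟨hpos, hall⟩ := isReducedLongWord_iff.1 hlong
  -- Invariant: allowed moves have brought `α_{i_k}` directly behind a sorted prefix whose roots are
  -- exactly those of leading index below `m`. It holds for the original word at `m = k` and is
  -- carried down to `m = 0`.
  have key : ∀ m : ℕ, m ≤ k → ∃ (U : List b.support) (c : b.support) (V : List b.support),
      Relation.ReflTransGen (AllowedMove b (e k)) l (U ++ c :: V) ∧
      wordProd b U (P.root c) = P.root (e k) ∧ PosWord b U ∧
      (rootSeq b U).Pairwise (LexLT b e) ∧
      ∀ x, IsPosRoot b x → (x ∈ rootSeq b U ↔ HasLowCoord e m x) := by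
    intro m hm
    induction hm using Nat.decreasingInduction with
    | self =>
      obtain ⟨U, c, V, rfl, h⟩ := exists_split_of_mem_rootSeq (hall _ (isPosRoot_root (e k)))
      rw [rootSeq_append, rootSeq_cons, List.map_cons, ← h] at hall hsorted
      rw [List.pairwise_append, List.pairwise_cons] at hsorted
      refine ⟨U, c, V, .refl, h.symm, hpos.of_append, hsorted.1, fun x hx => ?_⟩
      rw [← lexLT_root_iff hx]
      refine ⟨fun hxU => hsorted.2.2 x hxU _ List.mem_cons_self, fun hlt => ?_⟩
      rcases List.mem_append.1 (hall x hx) with h | h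
      · exact h
      rcases List.mem_cons.1 h with rfl | h
      · exact absurd hlt (LexLT.irrefl hx)
      · exact absurd (hsorted.2.1.1 x h) (hlt.asymm hx (isPosRoot_root _))
    | of_succ m hm ih =>
      obtain ⟨W, c, V, hreach, hroot, hWpos, hWs, hW⟩ := ih
      let m' : Fin n := ⟨m, hm.trans k.2⟩
      obtain ⟨L₁, L₂, hL, h1, h2⟩ := exists_append_of_pairwise (p := HasLowCoord e m)
        (fun x y h hy => h.hasLowCoord hy) hWs
      obtain ⟨U, A, rfl, hUL⟩ : ∃ U A, W = U ++ A ∧ rootSeq b U = L₁ :=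
        ⟨W.take L₁.length, W.drop L₁.length, (List.take_append_drop _ _).symm, by
          rw [rootSeq_take, hL, List.take_left]⟩
      have hAL : (rootSeq b A).map (wordProd b U) = L₂ := by
        rw [rootSeq_append, hUL] at hL
        exact List.append_cancel_left hL
      have hU : ∀ x, IsPosRoot b x → (x ∈ rootSeq b U ↔ HasLowCoord e m' x) := by
        intro x hx
        rw [hUL]
        refine ⟨h1 x, fun hlow => ?_⟩
        have hx' := (hW x hx).2 (hlow.imp fun j hj => ⟨Nat.lt_succ_of_lt hj.1, hj.2⟩)
        rw [hL, List.mem_append] at hx'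
        exact hx'.resolve_right fun h => h2 x h hlow
      have hUpos : PosWord b U := hWpos.of_append
      have hkm : m' < k := hm
      have hA : ∀ x ∈ (rootSeq b A).map (wordProd b U), x ∈ leadingRoots e m' := by
        intro x hx
        have hxW : x ∈ rootSeq b (U ++ A) := by
          rw [rootSeq_append]
          exact List.mem_append_right _ hx
        have hxpos := hWpos x hxW
        have hnot := h2 x (hAL ▸ hx)
        refine ⟨hxpos, hnot, ?_⟩
        obtain ⟨j, hj, hxj⟩ := (hW x hxpos).1 hxW
        have : (j : ℕ) = m := by
          by_contra hne
          exact hnot ⟨j, by omega, hxj⟩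
        rwa [show m' = j from Fin.ext this.symm]
      obtain ⟨c', V', hreach', hroot'⟩ :=
        (isBraidlessRegion_leadingRoots (he m') hUpos hU).exists_move (j := e k)
          (fun β hβ => hβ.1) (fun β hβ hS => hS.2.1 ((hU β hS.1).1 hβ))
          -- Subtracting a multiple of `α_{i_k}` changes only coordinate `k > m`, so the coordinate
          -- at `m` stays positive and the lower ones stay zero.
          (fun β hβ p q hp hmem => by
            have hcoord : ∀ i : Fin n, i < k → coord b e (p • β - q • P.root (e k)) i =
                p * coord b e β i := by
              intro i hi
              rw [sub_eq_add_neg, coord_add, coord_neg, coord_smul, coord_smul, coord_root,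
                if_neg hi.ne', mul_zero, neg_zero, add_zero]
            have hβm : 0 < coord b e β m' := lt_of_le_of_ne (hβ.1.coord_nonneg _) hβ.2.2.symm
            have hm0 : 0 < coord b e (p • β - q • P.root (e k)) m' := by
              rw [hcoord m' hkm]
              exact mul_pos hp hβm
            refine ⟨isPosRoot_of_repr_pos hmem (e m') hm0, ?_, hm0.ne'⟩
            rintro ⟨i, hi, hne⟩
            rw [hcoord i (lt_trans (show i < m' from hi) hkm)] at hne
            exact hβ.2.1 ⟨i, hi, right_ne_zero_of_mul hne⟩)
          ⟨1, one_mem _, one_mul _⟩ A c V hWpos hA hroot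
      refine ⟨U, c', V', hreach.trans hreach', hroot', hUpos, ?_, hU⟩
      rw [hUL]
      rw [hL] at hWs
      exact (List.pairwise_append.1 hWs).1
  obtain ⟨U, c, V, hreach, hroot, hUpos, -, hU⟩ := key 0 (Nat.zero_le _)
  -- No root has a nonzero coordinate of index below `0`, so nothing is left in front of `α_{i_k}`.
  have hnil : U = [] := by
    rw [← List.length_eq_zero_iff, ← length_rootSeq (b := b), List.length_eq_zero_iff,
      List.eq_nil_iff_forall_not_mem]
    intro x hx
    obtain ⟨j, hj, -⟩ := (hU x (hUpos x hx)).1 hx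
    exact absurd hj (Nat.not_lt_zero _)
  subst hnil
  refine ⟨c :: V, by simpa using hreach, ?_⟩
  rw [List.head?_cons, root_injective (i := c) (j := e k) (by simpa using hroot)]

end Enumeration

/-! ### Good enumerations in the classical types. -/

section GoodEnumerations

variable {n : ℕ} {e : Fin n ≃ b.support} {A : Matrix (Fin n) (Fin n) ℤ}

/-- Braidlessness can be read off from any set `X` of integral weights that contains the fundamental
weight and is stable under the simple reflections; `val x j` is the pairing of the weight `x` with
the `j`-th simple coroot. -/
lemma isBraidless_of_weights (hA : ∀ i j, b.cartanMatrix (e i) (e j) = A i j) (k : Fin n)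
    {X : Type*} (val : X → Fin n → ℤ) (x₀ : X)
    (h₀ : ∀ j, k ≤ j → val x₀ j = if j = k then 1 else 0)
    (hrefl : ∀ x j, k ≤ j → ∃ y, ∀ l, k ≤ l → val y l = val x l - val x j * A j l)
    (hpos : ∀ x j l, k ≤ j → k ≤ l → j ≠ l → 0 < val x j → 0 < val x l → A l j = 0) :
    IsBraidless b (e '' Set.Ici k) (e k) := by
  have hpair : ∀ i j, P.coroot' (e j) (P.root (e i)) = (A i j : K) := by
    intro i j
    rw [P.root_coroot'_eq_pairing, ← hA, ← P.algebraMap_pairingIn ℤ]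
    rfl
  rintro ω ⟨-, hω1, hω0⟩ τ hτ
  obtain ⟨w, hw, rfl⟩ := exists_wordProd_of_mem_parabolic hτ
  obtain ⟨x, hx⟩ : ∃ x, ∀ j, k ≤ j → P.coroot' (e j) (wordProd b w ω) = (val x j : K) := by
    clear hτ
    induction w with
    | nil =>
      refine ⟨x₀, fun j hj => ?_⟩
      rw [h₀ j hj, wordProd_nil]
      change P.coroot' (e j) ω = _
      by_cases hjk : j = k
      · subst hjk
        simpa using hω1
      · simpa [hjk] using hω0 (e j) ⟨j, hj, rfl⟩ (fun h => hjk (e.injective h))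
    | cons i w ih =>
      obtain ⟨x, hx⟩ := ih fun j hj => hw j (List.mem_cons_of_mem _ hj)
      obtain ⟨j, hj, rfl⟩ := hw i List.mem_cons_self
      obtain ⟨y, hy⟩ := hrefl x j hj
      refine ⟨y, fun l hl => ?_⟩
      rw [wordProd_cons, LinearEquiv.mul_apply, P.reflection_apply, map_sub, map_smul, hpair,
        hx l hl, hx j hj, hy l hl]
      push_cast
      rfl
  rintro - ⟨j, hj, rfl⟩ - ⟨l, hl, rfl⟩ hjl hj0 hl0
  rw [hx j hj, Int.cast_pos] at hj0
  rw [hx l hl, Int.cast_pos] at hl0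
  rw [hpair, hpos x j l hj hl (fun h => hjl (congrArg e h)) hj0 hl0, Int.cast_zero]

lemma isBraidless_of_forall_eq_zero (hA : ∀ i j, b.cartanMatrix (e i) (e j) = A i j) (k : Fin n)
    (h : ∀ j l, k ≤ j → k ≤ l → j ≠ l → A l j = 0) : IsBraidless b (e '' Set.Ici k) (e k) := by
  rintro ω - τ - - ⟨j, hj, rfl⟩ - ⟨l, hl, rfl⟩ hjl - -
  rw [P.root_coroot'_eq_pairing, ← P.algebraMap_pairingIn ℤ]
  change algebraMap ℤ K (b.cartanMatrix (e l) (e j)) = 0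
  rw [hA, h j l hj hl (fun h => hjl (congrArg e h)), map_zero]

/-- The number `t` stands for the weight `ε_t` and the coroot of node `j` for `ε_j - ε_{j+1}`; such
a weight is positive on at most one node. -/
lemma isGoodEnumeration_A (hA : ∀ i j, b.cartanMatrix (e i) (e j) = CartanMatrix.A n i j) :
    IsGoodEnumeration b e := by
  intro k
  refine isBraidless_of_weights hA k (X := ℕ)
    (fun t j => (if t = j then 1 else 0) - (if t = j + 1 then 1 else 0)) k ?_ ?_ ?_
  · intro j hj
    simp only [Fin.ext_iff, Fin.le_def] at *
    split_ifs <;> omega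
  · intro t j hj
    refine ⟨if t = j then j + 1 else if t = j + 1 then j else t, fun l hl => ?_⟩
    simp only [CartanMatrix.A, Matrix.of_apply, Fin.ext_iff]
    grind
  · intro t j l hj hl hjl h1 h2
    simp only [ne_eq, Fin.ext_iff] at *
    grind

/-- The pair `(s, t)` stands for `±ε_t`, and the last coroot is twice the last `ε`, which is the
source of the value `2`. -/
lemma isGoodEnumeration_B (hA : ∀ i j, b.cartanMatrix (e i) (e j) = CartanMatrix.B n i j) :
    IsGoodEnumeration b e := by
  intro k
  -- At the last node the fundamental weight is half of `ε_k`, outside the model, but only one node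
  -- remains.
  by_cases hk : (k : ℕ) + 1 = n
  · refine isBraidless_of_forall_eq_zero hA k fun j l hj hl hjl => ?_
    simp only [ne_eq, Fin.ext_iff, Fin.le_def] at *
    omega
  refine isBraidless_of_weights hA k (X := Bool × ℕ)
    (fun x j => (if x.1 then 1 else -1) * (if (j : ℕ) + 1 = n then (if x.2 = j then 2 else 0)
      else (if x.2 = j then 1 else 0) - (if x.2 = j + 1 then 1 else 0))) (true, k) ?_ ?_ ?_
  · intro j hj
    simp only [Fin.ext_iff, Fin.le_def] at *
    grind
  · rintro ⟨s, t⟩ j hj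
    refine ⟨if (j : ℕ) + 1 = n then (if t = j then (!s, t) else (s, t))
      else (s, if t = j then j + 1 else if t = j + 1 then j else t), fun l hl => ?_⟩
    simp only [CartanMatrix.B, Matrix.of_apply, Fin.ext_iff]
    cases s <;> grind
  · rintro ⟨s, t⟩ j l hj hl hjl h1 h2
    simp only [ne_eq, Fin.ext_iff] at *
    cases s <;> grind

/-- As in type `B`, with last coroot equal to the last `ε`; the model therefore covers the last node
too. -/
lemma isGoodEnumeration_C (hA : ∀ i j, b.cartanMatrix (e i) (e j) = CartanMatrix.C n i j) :
    IsGoodEnumeration b e := by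
  intro k
  refine isBraidless_of_weights hA k (X := Bool × ℕ)
    (fun x j => (if x.1 then 1 else -1) * (if (j : ℕ) + 1 = n then (if x.2 = j then 1 else 0)
      else (if x.2 = j then 1 else 0) - (if x.2 = j + 1 then 1 else 0))) (true, k) ?_ ?_ ?_
  · intro j hj
    simp only [Fin.ext_iff, Fin.le_def] at *
    grind
  · rintro ⟨s, t⟩ j hj
    refine ⟨if (j : ℕ) + 1 = n then (if t = j then (!s, t) else (s, t))
      else (s, if t = j then j + 1 else if t = j + 1 then j else t), fun l hl => ?_⟩
    simp only [CartanMatrix.C, Matrix.of_apply, Fin.ext_iff]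
    cases s <;> grind
  · rintro ⟨s, t⟩ j l hj hl hjl h1 h2
    simp only [ne_eq, Fin.ext_iff] at *
    cases s <;> grind

/-- The last coroot is `ε_{n-2} + ε_{n-1}`, and its reflection exchanges `ε_{n-2}` with `-ε_{n-1}`.
The weight `ε_{n-2}` is positive on both of the last two nodes, but these are orthogonal. -/
lemma isGoodEnumeration_D (hn : 3 ≤ n)
    (hA : ∀ i j, b.cartanMatrix (e i) (e j) = CartanMatrix.D n i j) :
    IsGoodEnumeration b e := by
  intro k
  -- From node `n - 2` on the fundamental weights are spin weights, outside the model; the remaining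
  -- nodes are pairwise orthogonal.
  by_cases hk : n ≤ (k : ℕ) + 2
  · refine isBraidless_of_forall_eq_zero hA k fun j l hj hl hjl => ?_
    simp only [CartanMatrix.D, Matrix.of_apply, ne_eq, Fin.ext_iff, Fin.le_def] at *
    grind
  refine isBraidless_of_weights hA k (X := Bool × ℕ)
    (fun x j => (if x.1 then 1 else -1) * (if (j : ℕ) + 1 = n then
        (if x.2 + 2 = n ∨ x.2 + 1 = n then 1 else 0)
      else (if x.2 = j then 1 else 0) - (if x.2 = j + 1 then 1 else 0))) (true, k) ?_ ?_ ?_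
  · intro j hj
    simp only [Fin.ext_iff, Fin.le_def] at *
    grind
  · rintro ⟨s, t⟩ j hj
    refine ⟨if (j : ℕ) + 1 = n then
        (if t + 2 = n then (!s, t + 1) else if t + 1 = n then (!s, t - 1) else (s, t))
      else (s, if t = j then j + 1 else if t = j + 1 then j else t), fun l hl => ?_⟩
    simp only [CartanMatrix.D, Matrix.of_apply, Fin.ext_iff]
    by_cases hjn : (j : ℕ) + 1 = n
    · simp only [hjn, if_true]
      by_cases ht : t + 2 = n
      · cases s <;> grind
      by_cases ht' : t + 1 = n <;> cases s <;> grind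
    · simp only [hjn, if_false]
      by_cases ht : t = j
      · by_cases hln : (l : ℕ) + 1 = n <;> simp only [ht, hln, if_true, if_false] <;>
          cases s <;> grind
      by_cases ht' : t = j + 1
      · by_cases hln : (l : ℕ) + 1 = n <;> simp only [ht', hln, if_true, if_false] <;>
          cases s <;> grind
      simp [ht, ht']
  · rintro ⟨s, t⟩ j l hj hl hjl h1 h2
    simp only [CartanMatrix.D, Matrix.of_apply, ne_eq, Fin.ext_iff] at *
    cases s <;> grind

end GoodEnumerations

/-! ### Exceptional types by computing weight orbits. -/

/-- The entry in row `i` and column `j` of a matrix given by its rows. -/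
def rowsEntry (R : List (List ℤ)) (i j : ℕ) : ℤ := (R.getD i []).getD j 0

/-- The reflection with index `j` in coordinates with respect to the fundamental weights, for the
Cartan matrix with rows `R`. -/
def reflectWeight (R : List (List ℤ)) (j : ℕ) (f : List ℤ) : List ℤ :=
  (List.range R.length).map fun l => f.getD l 0 - f.getD j 0 * rowsEntry R j l

/-- The weights obtained from those in `F` by a reflection with index at least `k` at a positive
coordinate. -/
def lowerWeights (R : List (List ℤ)) (k : ℕ) (F : List (List ℤ)) : List (List ℤ) :=
  (F.flatMap fun f => ((List.range R.length).filter fun j =>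
    decide (k ≤ j ∧ 0 < f.getD j 0)).map fun j => reflectWeight R j f).dedup

/-- The weights obtained from those in `F` by at most `t` lowering reflections. -/
def weightOrbit (R : List (List ℤ)) (k : ℕ) : ℕ → List (List ℤ) → List (List ℤ)
  | 0, F => F
  | t + 1, F => F ++ weightOrbit R k t (lowerWeights R k F)

/-- The fundamental weight with index `k`. -/
def fundamentalWeight (n k : ℕ) : List ℤ := (List.range n).map fun l => if l = k then 1 else 0

/-- The list `L` of weights is stable under the reflections with index at least `k`, contains the
fundamental weight, and satisfies the condition in the definition of braidlessness. -/
def IsBraidlessList (R : List (List ℤ)) (n k : ℕ) (L : List (List ℤ)) : Prop :=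
  fundamentalWeight n k ∈ L ∧ ∀ f ∈ L, ∀ j : Fin n, k ≤ j →
    reflectWeight R j f ∈ L ∧
      ∀ l : Fin n, k ≤ l → j ≠ l → 0 < f.getD j 0 → 0 < f.getD l 0 → rowsEntry R l j = 0

instance (R : List (List ℤ)) (n k : ℕ) (L : List (List ℤ)) : Decidable (IsBraidlessList R n k L) :=
  by unfold IsBraidlessList; infer_instance

lemma isBraidless_of_list {n : ℕ} {e : Fin n ≃ b.support} (R : List (List ℤ)) (hR : R.length = n)
    (hA : ∀ i j, b.cartanMatrix (e i) (e j) = rowsEntry R i j) (k : Fin n) {L : List (List ℤ)}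
    (hL : IsBraidlessList R n k L) : IsBraidless b (e '' Set.Ici k) (e k) := by
  refine isBraidless_of_weights (A := fun i j => rowsEntry R i j) hA k
    (X := {f : List ℤ // f ∈ L}) (fun f j => f.1.getD j 0) ⟨_, hL.1⟩ ?_ ?_ ?_
  · intro j _
    simp [fundamentalWeight, List.getD_eq_getElem?_getD, Fin.ext_iff]
  · rintro ⟨f, hf⟩ j hj
    refine ⟨⟨_, (hL.2 f hf j hj).1⟩, fun l _ => ?_⟩
    simp [reflectWeight, List.getD_eq_getElem?_getD, hR]
  · rintro ⟨f, hf⟩ j l hj hl hjl h1 h2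
    exact (hL.2 f hf j hj).2 l hl hjl h1 h2

/-- The rows of the Cartan matrix of type `E₆`, for an enumeration starting with a minuscule node. -/
def rowsE₆ : List (List ℤ) :=
  [[2, 0, 0, 0, -1, 0], [0, 2, -1, 0, 0, 0], [0, -1, 2, 0, 0, -1], [0, 0, 0, 2, 0, -1],
    [-1, 0, 0, 0, 2, -1], [0, 0, -1, -1, -1, 2]]

/-- The rows of the Cartan matrix of type `E₇`, for an enumeration starting with the minuscule
node. -/
def rowsE₇ : List (List ℤ) :=
  [[2, 0, -1, 0, 0, 0, 0], [0, 2, 0, 0, 0, -1, 0], [-1, 0, 2, -1, 0, 0, 0],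
    [0, 0, -1, 2, 0, 0, -1], [0, 0, 0, 0, 2, 0, -1], [0, -1, 0, 0, 0, 2, -1],
    [0, 0, 0, -1, -1, -1, 2]]

/-- The rows of the Cartan matrix of type `G₂`. -/
def rowsG₂ : List (List ℤ) := [[2, -3], [-1, 2]]

/-- The bound `16` is the depth of the orbit of 27 minuscule weights, as `27` is for the 56 weights
of `E₇`. The bound only has to be large enough: stability of the resulting list is part of what is
checked. -/
lemma isBraidlessList_E₆ (k : Fin 6) :
    IsBraidlessList rowsE₆ 6 k (weightOrbit rowsE₆ k 16 [fundamentalWeight 6 k]) := by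
  revert k
  decide +kernel

lemma isBraidlessList_E₇ (k : Fin 7) :
    IsBraidlessList rowsE₇ 7 k (weightOrbit rowsE₇ k 27 [fundamentalWeight 7 k]) := by
  revert k
  decide +kernel

lemma isBraidlessList_G₂ (k : Fin 2) :
    IsBraidlessList rowsG₂ 2 k (weightOrbit rowsG₂ k 6 [fundamentalWeight 2 k]) := by
  revert k
  decide +kernel

/-- The order of the nodes of `E₆` in which `rowsE₆` is written. -/
def nodesE₆ : Fin 6 ≃ Fin 6 where
  toFun := ![0, 5, 4, 1, 2, 3]
  invFun := ![0, 3, 4, 5, 2, 1]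
  left_inv := by decide
  right_inv := by decide

/-- The order of the nodes of `E₇` in which `rowsE₇` is written. -/
def nodesE₇ : Fin 7 ≃ Fin 7 where
  toFun := ![6, 0, 5, 4, 1, 2, 3]
  invFun := ![1, 4, 5, 6, 3, 2, 0]
  left_inv := by decide
  right_inv := by decide

lemma exists_isGoodEnumeration (h : HasTypeOtherThanE8F4 b) :
    ∃ (n : ℕ) (e : Fin n ≃ b.support), IsGoodEnumeration b e := by
  rcases h with ⟨n, _, e, he⟩ | ⟨n, _, e, he⟩ | ⟨n, _, e, he⟩ | ⟨n, hn, e, he⟩ | ⟨e, he⟩ | ⟨e, he⟩ |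
    ⟨e, he⟩
  · exact ⟨n, e, isGoodEnumeration_A he⟩
  · exact ⟨n, e, isGoodEnumeration_B he⟩
  · exact ⟨n, e, isGoodEnumeration_C he⟩
  · exact ⟨n, e, isGoodEnumeration_D (by omega) he⟩
  -- Removing the first node of `E₆` leaves `D₅`, which continues with its vector node. The order
  -- for `E₇` is its minuscule node followed by this order for `E₆`.
  · refine ⟨6, nodesE₆.trans e, fun k => isBraidless_of_list (n := 6) rowsE₆ rfl (fun i j => ?_) k
      (isBraidlessList_E₆ k)⟩
    rw [Equiv.trans_apply, Equiv.trans_apply, he]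
    revert i j
    decide
  · refine ⟨7, nodesE₇.trans e, fun k => isBraidless_of_list (n := 7) rowsE₇ rfl (fun i j => ?_) k
      (isBraidlessList_E₇ k)⟩
    rw [Equiv.trans_apply, Equiv.trans_apply, he]
    revert i j
    decide
  · refine ⟨2, e, fun k => isBraidless_of_list (n := 2) rowsG₂ rfl (fun i j => ?_) k
      (isBraidlessList_G₂ k)⟩
    rw [he]
    fin_cases i <;> fin_cases j <;> rfl

end SimplyBraided

open SimplyBraided in
theorem lemma4p10 {ι K M N : Type*} [Field K] [LinearOrder K] [IsStrictOrderedRing K]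
    [AddCommGroup M] [Module K M] [AddCommGroup N] [Module K N] [Finite ι]
    (P : RootPairing ι K M N) [P.IsRootSystem] [P.IsCrystallographic] [P.IsReduced]
    (b : P.Base) :
    (∀ (n : ℕ) (e : Fin n ≃ b.support), IsGoodEnumeration b e →
      (∃! l : List b.support, IsLexWord b e l) ∧
      ∀ l : List b.support, IsLexWord b e l → IsSimplyBraided b l) ∧
    (HasTypeOtherThanE8F4 b →
      (∃ (n : ℕ) (e : Fin n ≃ b.support), IsGoodEnumeration b e) ∧
      ∃ l : List b.support, IsReducedLongWord b l ∧ IsSimplyBraided b l) := by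
  refine ⟨fun n e he => ⟨existsUnique_isLexWord e, fun l hl => hl.isSimplyBraided he⟩, fun h => ?_⟩
  obtain ⟨n, e, he⟩ := exists_isGoodEnumeration h
  obtain ⟨l, hl, -⟩ := existsUnique_isLexWord e
  exact ⟨⟨n, e, he⟩, l, hl.1, hl.isSimplyBraided he⟩
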